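/- We work in the deterministic $\mathsf{CONGEST}$ model. A network is a simple graph $G=(V,E)$ with $n$ nodes. The nodes have unique identifiers of at most $c_{\mathrm{id}}\lceil\log_2 n\rceil$ bits, and each node numbers its incident edges by ports in an arbitrary way. Initially a node knows its own identifier, its degree, its own input, and the global parameters ($n$, an upper bound $\Delta$ on the maximum degree, and the color space $\mathcal C$). Computation proceeds in synchronous rounds; in each round every node may send a (possibly different) message of at most $c_{\mathrm{msg}}\lceil\log_2 n\rceil$ bits to each of its neighbors. Local computation is unrestricted, and each node outputs its own color at the end. In $(\deg+1)$-list coloring, the input of node $v$ is a list $L_v\subseteq\mathcal C$ with $|L_v|\ge\deg(v)+1$, and node $v$ has to output a color in $L_v$ such that adjacent nodes output distinct colors. Let $\log^* n$ denote the least number of iterations of $\log_2$ that take $n$ to a value at most $1$. **Corollary.** Let $c_{\mathrm{id}},c_{\mathrm{msg}}\ge 1$ and $b,k\ge 0$ be integers and let $a,K$ be real numbers. There are constants $A$ and $\beta$, depending only on $c_{\mathrm{id}},c_{\mathrm{msg}},a,b,K,k$, such that the following holds for all $n,\Delta$ with $\Delta\le a\,\log_2 n\cdot(\log_2(\log_2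 n+2))^{b}$ (that is, $\Delta=\tilde O(\log n)$) and every nonempty finite color space $\mathcal C$ with $|\mathcal C|\le K(\Delta+1)^k$ (that is, $|\mathcal C|=\mathrm{poly}(\Delta)$). There is a deterministic $\mathsf{CONGEST}$ algorithm that solves $(\deg+1)$-list coloring with lists from $\mathcal C$ on all $n$-node graphs of maximum degree at most $\Delta$ in at most $$A\sqrt{\Delta}\,\bigl(\log_2(\sqrt\Delta+2)\bigr)^{\beta}+\tfrac12\log^* n \;=\;\tilde O(\sqrt\Delta)+\tfrac12\log^* n$$ rounds. In particular, for constants $A,\beta$ depending only on $c_{\mathrm{id}},c_{\mathrm{msg}},a,b$, under the same assumption on $n,\Delta$ there is a deterministic $\mathsf{CONGEST}$ algorithm that computes a proper coloring with $\Delta+1$ colors on all $n$-node graphs of maximum degree at most $\Delta$ within the same number of rounds. -/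

import Mathlib

/-- The iterated logarithm `log* x`: the least number of applications of `log₂` after which the
value is at most `1`. -/
noncomputable def logStar (x : ℝ) : ℕ :=
  sInf {k : ℕ | (Real.logb 2)^[k] x ≤ 1}

/-- The function `a · x · (log x)^b`, where `log₂ (x + 2)` stands for `log x` so that the logarithmic
factor is at least `1` for all `x ≥ 0`.  A quantity is `Õ(x)` if it is at most `softO a b x` for
some constants `a`, `b`. -/
noncomputable def softO (a : ℝ) (b : ℕ) (x : ℝ) : ℝ :=
  a * x * (Real.logb 2 (x + 2)) ^ b

/-- Messages of at most `B` bits. -/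
def BitMessage (B : ℕ) : Type := {w : List Bool // w.length ≤ B}

/-- A deterministic synchronous message passing algorithm with messages of at most `B` bits, for
nodes with inputs of type `I` and outputs of type `O`.  The `d` ports of a node of degree `d` are
numbered `0, …, d - 1`.
* `init d i x` is the initial state of a node of degree `d` with identifier `i` and input `x`;
* `send s p` is the message that a node in state `s` sends through its port `p`;
* `recv d s m` is the next state of a node of degree `d` in state `s` that receives the message
  `m p` through port `p`;
* `output s` is the output of a node that stops in state `s`.
Local computation is unrestricted. -/
structure CongestAlgorithm (B : ℕ) (I O : Type*) where
  State : Type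
  init : ℕ → ℕ → I → State
  send : State → ℕ → BitMessage B
  recv : (d : ℕ) → State → (Fin d → BitMessage B) → State
  output : State → O

/-- A port numbering: every node numbers its incident edges, in an arbitrary way. -/
abbrev PortNumbering {V : Type*} [Fintype V] (G : SimpleGraph V) [DecidableRel G.Adj] : Type _ :=
  (v : V) → Fin (G.degree v) ≃ G.neighborSet v

namespace CongestAlgorithm

variable {B : ℕ} {I O V : Type*} [Fintype V]

/-- The state of node `v` after `t` rounds.  In a round, the message that `v` receives through its
port `p` is the one that the neighbor `u` behind this port sends through the port of `u` that leads
to `v`. -/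
def stateAt (alg : CongestAlgorithm B I O) (G : SimpleGraph V) [DecidableRel G.Adj]
    (P : PortNumbering G) (ident : V → ℕ) (input : V → I) : ℕ → V → alg.State
  | 0, v => alg.init (G.degree v) (ident v) (input v)
  | t + 1, v => alg.recv (G.degree v) (stateAt alg G P ident input t v) fun p =>
      alg.send (stateAt alg G P ident input t (P v p).1)
        ((P (P v p).1).symm ⟨v, SimpleGraph.Adj.symm (P v p).2⟩).1

/-- The output of node `v` when the execution stops after `T` rounds. -/
def outputAt (alg : CongestAlgorithm B I O) (G : SimpleGraph V) [DecidableRel G.Adj]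
    (P : PortNumbering G) (ident : V → ℕ) (input : V → I) (T : ℕ) (v : V) : O :=
  alg.output (alg.stateAt G P ident input T v)

end CongestAlgorithm

/-- Unique identifiers of at most `b` bits. -/
def ValidIds {V : Type*} (b : ℕ) (ident : V → ℕ) : Prop :=
  Function.Injective ident ∧ ∀ v, ident v < 2 ^ b

/-- `T` rounds of `alg` solve `(deg+1)`-list coloring with color space `C` on all graphs with `n`
nodes, maximum degree at most `Δ` and unique identifiers of at most `b` bits.  The input of a node
is its list of colors. -/
def SolvesListColoring {B : ℕ} {C : Type*} (alg : CongestAlgorithm B (Finset C) C)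
    (n Δ b T : ℕ) : Prop :=
  ∀ (V : Type) [Fintype V] (G : SimpleGraph V) [DecidableRel G.Adj] (P : PortNumbering G)
    (ident : V → ℕ) (L : V → Finset C),
    Fintype.card V = n → (∀ v, G.degree v ≤ Δ) → ValidIds b ident →
    (∀ v, G.degree v + 1 ≤ (L v).card) →
    (∀ v, alg.outputAt G P ident L T v ∈ L v) ∧
      ∀ u v, G.Adj u v → alg.outputAt G P ident L T u ≠ alg.outputAt G P ident L T v

/-- `T` rounds of `alg` solve `(Δ+1)`-coloring on all graphs with `n` nodes, maximum degree at most
`Δ` and unique identifiers of at most `b` bits.  The nodes have no input besides the identifiers. -/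
def SolvesColoring {B Δ : ℕ} (alg : CongestAlgorithm B Unit (Fin (Δ + 1)))
    (n b T : ℕ) : Prop :=
  ∀ (V : Type) [Fintype V] (G : SimpleGraph V) [DecidableRel G.Adj] (P : PortNumbering G)
    (ident : V → ℕ),
    Fintype.card V = n → (∀ v, G.degree v ≤ Δ) → ValidIds b ident →
    ∀ u v, G.Adj u v →
      alg.outputAt G P ident (fun _ => ()) T u ≠ alg.outputAt G P ident (fun _ => ()) T v

/-! The term `½ log* n` pays for an initial coloring with `poly(Δ)` colors, and `Õ(√Δ)` pays for a
list coloring based on it. Since `Δ = Õ(log n)` and `|C| = poly(Δ)`, the `Õ(Δ)` bits that describe a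
node with its list of at most `Δ + 1` colors fit into `polylog(Δ)` messages, so that nodes can
broadcast their whole state cheaply.

Initial coloring. For each pair of ports `(i, j)`, the arcs with port `i` at the tail and port `j`
at the head form a graph of indegree and outdegree at most one. Cole–Vishkin reduction runs on all
these graphs at once, with only two colors crossing an edge per exchange. One exchange yields two
reduction steps (`doubleStep_ne`): the first uses the successor, the second uses the predecessor,
whose reduced color depends only on its own color and that of the node. This gives the factor `1/2`.
The tuple of all reverse ports and constant-size edge colors properly colors `G`
(`PortState.tuple_run_ne`), and one step of Linial (`exists_linial`) leaves `p ^ 2 = poly(Δ)`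
colors.

List coloring. Let uncolored nodes have at most `m` available colors. A polynomial code splits them
into `q` classes with at most `β = 2 * d * m / q` outneighbors per node
(`NodeState.decomposed_of_code`). The classes are colored one after another, each in a constant
number of broadcasts. By a counting argument (`exists_candidates`) a node can choose a set of `β * τ
+ 1` available colors that shares at most `τ` colors with any set an outneighbor might choose; so
some color in it lies in no set of an outneighbor. This needs about `(β * τ) ^ 2` available colors,
which is less than `m / 2` once `q` is about `d * τ * √Δ` with `d` and `τ` of order `log Δ`
(`outdegree_bounds`). Hence each stage of `O(q)` broadcasts halves the number of available colors,
which always exceeds the number of uncolored neighbors, and `O(log Δ)` stages color every node. -/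

/-! ### Networks and composition of algorithms. -/

/-- A network together with identifiers and inputs of its nodes. -/
structure Net (I : Type) where
  V : Type
  [fintypeV : Fintype V]
  G : SimpleGraph V
  [decAdj : DecidableRel G.Adj]
  P : PortNumbering G
  ident : V → ℕ
  input : V → I

attribute [instance] Net.fintypeV Net.decAdj

namespace Net

variable {I : Type} (N : Net I)

/-- The neighbor behind port `p` of `v`. -/
def nbr (v : N.V) (p : Fin (N.G.degree v)) : N.V := (N.P v p).1

/-- The port of the neighbor behind port `p` of `v` that leads back to `v`. -/
def back (v : N.V) (p : Fin (N.G.degree v)) : ℕ :=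
  ((N.P (N.P v p).1).symm ⟨v, SimpleGraph.Adj.symm (N.P v p).2⟩).1

/-- The edge between `v` and `u` has port `i` at `v` and port `j` at `u`. -/
def Link (v : N.V) (i : ℕ) (u : N.V) (j : ℕ) : Prop :=
  (∃ h : i < N.G.degree v, N.nbr v ⟨i, h⟩ = u) ∧ (∃ h : j < N.G.degree u, N.nbr u ⟨j, h⟩ = v)

variable {N}

theorem Link.symm {v u : N.V} {i j : ℕ} (h : N.Link v i u j) : N.Link u j v i := ⟨h.2, h.1⟩

theorem exists_link {v u : N.V} (h : N.G.Adj v u) : ∃ i j, N.Link v i u j := by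
  refine ⟨((N.P v).symm ⟨u, h⟩).1, ((N.P u).symm ⟨v, h.symm⟩).1, ⟨Fin.is_lt _, ?_⟩, ⟨Fin.is_lt _, ?_⟩⟩ <;>
  simp [nbr]

theorem Link.back_eq {v u : N.V} {i j : ℕ} (h : N.Link v i u j) (hi : i < N.G.degree v) :
    N.back v ⟨i, hi⟩ = j := by
  obtain ⟨⟨hi', hu⟩, ⟨hj, hv⟩⟩ := h
  subst hu
  have : N.P (N.nbr v ⟨i, hi⟩) ⟨j, hj⟩ = ⟨v, SimpleGraph.Adj.symm (N.P v ⟨i, hi⟩).2⟩ :=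
    Subtype.ext hv
  show ((N.P (N.nbr v ⟨i, hi⟩)).symm ⟨v, SimpleGraph.Adj.symm (N.P v ⟨i, hi⟩).2⟩).1 = j
  rw [← this, Equiv.symm_apply_apply]

theorem link_back (v : N.V) (p : Fin (N.G.degree v)) :
    N.Link v p (N.nbr v p) (N.back v p) := by
  refine ⟨⟨p.2, rfl⟩, ⟨Fin.is_lt _, ?_⟩⟩
  show ((N.P (N.P v p).1) ((N.P (N.P v p).1).symm ⟨v, SimpleGraph.Adj.symm (N.P v p).2⟩)).1 = v
  rw [Equiv.apply_symm_apply]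

end Net

/-- The message without bits. -/
def BitMessage.empty (B : ℕ) : BitMessage B := ⟨[], Nat.zero_le _⟩

/-- The message that consists of `B` given bits. -/
def BitMessage.ofBits {B : ℕ} (w : Fin B → Bool) : BitMessage B := ⟨List.ofFn w, by simp⟩

theorem BitMessage.ofBits_injective {B : ℕ} : Function.Injective (@BitMessage.ofBits B) :=
  fun _ _ h => List.ofFn_injective (congrArg Subtype.val h)

/-- `f` is the outcome of `T` rounds of some algorithm on the networks that satisfy `Ω`. -/
def RoundComputable (B : ℕ) {I S : Type} (Ω : Net I → Prop) (T : ℕ) (f : ∀ N : Net I, N.V → S) : Prop :=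
  ∃ alg : CongestAlgorithm B I S, ∀ N : Net I, Ω N → ∀ v,
    alg.outputAt N.G N.P N.ident N.input T v = f N v

namespace RoundComputable

variable {B : ℕ} {I S S' M : Type} {Ω : Net I → Prop} {T : ℕ} {f : ∀ N : Net I, N.V → S}

theorem init (φ : ℕ → ℕ → I → S) :
    RoundComputable B Ω 0 (fun N v => φ (N.G.degree v) (N.ident v) (N.input v)) :=
  ⟨{ State := S, init := φ, send := fun _ _ => BitMessage.empty B, recv := fun _ s _ => s,
     output := id }, fun _ _ _ => rfl⟩

theorem map (hf : RoundComputable B Ω T f) (φ : S → S') : RoundComputable B Ω T (fun N v => φ (f N v)) := by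
  obtain ⟨alg, h⟩ := hf
  refine ⟨⟨alg.State, alg.init, alg.send, alg.recv, fun s => φ (alg.output s)⟩, fun N hN v => ?_⟩
  have key : ∀ t, CongestAlgorithm.stateAt
      (⟨alg.State, alg.init, alg.send, alg.recv, fun s => φ (alg.output s)⟩ :
        CongestAlgorithm B I S') N.G N.P N.ident N.input t =
      alg.stateAt N.G N.P N.ident N.input t := by
    intro t
    induction t with
    | zero => rfl
    | succ t ih => funext v; simp only [CongestAlgorithm.stateAt, ih]
  have hv := h N hN v
  simp only [CongestAlgorithm.outputAt, key] at hv ⊢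
  rw [hv]

theorem congr {f' : ∀ N : Net I, N.V → S} (hf : RoundComputable B Ω T f)
    (h : ∀ N, Ω N → ∀ v, f N v = f' N v) : RoundComputable B Ω T f' := by
  obtain ⟨alg, ha⟩ := hf
  exact ⟨alg, fun N hN v => (ha N hN v).trans (h N hN v)⟩

/-- The algorithm that first runs `alg` for `T` rounds and then sends messages that are cut into
`r` blocks. -/
def thenSend (alg : CongestAlgorithm B I S) (T r : ℕ) (σ : S → ℕ → M)
    (enc : M → ℕ → BitMessage B) (dec : (ℕ → BitMessage B) → M)
    (ρ : (d : ℕ) → S → (Fin d → M) → S') : CongestAlgorithm B I S' where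
  State := alg.State × ℕ × ℕ × (ℕ → ℕ → BitMessage B)
  init d i x := (alg.init d i x, d, 0, fun _ _ => BitMessage.empty B)
  send s p := if s.2.2.1 < T then alg.send s.1 p else enc (σ (alg.output s.1) p) (s.2.2.1 - T)
  recv d s m :=
    if s.2.2.1 < T then (alg.recv d s.1 m, d, s.2.2.1 + 1, s.2.2.2)
    else (s.1, d, s.2.2.1 + 1, fun p i =>
      if h : p < d ∧ i = s.2.2.1 - T then m ⟨p, h.1⟩ else s.2.2.2 p i)
  output s := ρ s.2.1 (alg.output s.1)
    (fun p => dec fun i => if i < r then s.2.2.2 p i else BitMessage.empty B)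

theorem exists_code (r : ℕ) (A : Finset M) (hA : A.card ≤ 2 ^ (r * B)) [Nonempty M] :
    ∃ (enc : M → ℕ → BitMessage B) (dec : (ℕ → BitMessage B) → M), ∀ m ∈ A,
      dec (fun i => if i < r then enc m i else BitMessage.empty B) = m := by
  classical
  have hc : Fintype.card A ≤ Fintype.card (Fin r → Fin B → Bool) := by
    simpa [← pow_mul, mul_comm] using hA
  obtain ⟨e⟩ := Function.Embedding.nonempty_of_card_le hc
  let enc : M → ℕ → BitMessage B := fun m i =>
    if h : m ∈ A ∧ i < r then BitMessage.ofBits (e ⟨m, h.1⟩ ⟨i, h.2⟩) else BitMessage.empty B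
  let tr : (ℕ → BitMessage B) → (ℕ → BitMessage B) :=
    fun w i => if i < r then w i else BitMessage.empty B
  have inj : Set.InjOn (fun m => tr (enc m)) (A : Set M) := by
    intro m hm m' hm' h
    have hm1 : m ∈ A := hm
    have hm2 : m' ∈ A := hm'
    have : e ⟨m, hm⟩ = e ⟨m', hm'⟩ := by
      funext i
      have h1 := congrFun h i.1
      simp only [tr, enc, i.2, hm1, hm2, and_self, dif_pos, if_true] at h1
      exact BitMessage.ofBits_injective h1
    exact congrArg Subtype.val (e.injective this)
  refine ⟨enc, Function.invFunOn (fun m => tr (enc m)) (A : Set M), fun m hm => ?_⟩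
  exact inj.leftInvOn_invFunOn hm

/-- A message from a set of at most `2 ^ (r * B)` elements can be cut into `r` blocks of `B` bits,
so one exchange of large messages costs `r` rounds. With `r = 0` and trivial messages this is a
local computation that may use the degree. -/
theorem exchange (hf : RoundComputable B Ω T f) (r : ℕ) (σ : S → ℕ → M)
    (ρ : (d : ℕ) → S → (Fin d → M) → S') (A : Finset M) (hA : A.card ≤ 2 ^ (r * B))
    (hσ : ∀ N, Ω N → ∀ v, ∀ p < N.G.degree v, σ (f N v) p ∈ A) :
    RoundComputable B Ω (T + r) (fun N v =>
      ρ (N.G.degree v) (f N v) (fun p => σ (f N (N.nbr v p)) (N.back v p))) := by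
  classical
  obtain ⟨alg, h⟩ := hf
  by_cases hM : Nonempty M
  swap
  · refine ⟨⟨alg.State, alg.init, alg.send, alg.recv, fun s =>
      ρ 0 (alg.output s) Fin.elim0⟩, fun N hN v => ?_⟩
    exact (hM ⟨σ (f N v) 0⟩).elim
  obtain ⟨enc, dec, hed⟩ := exists_code (B := B) r A hA
  refine ⟨thenSend alg T r σ enc dec ρ, fun N hN v => ?_⟩
  have phase1 : ∀ t ≤ T, ∀ v, (thenSend alg T r σ enc dec ρ).stateAt N.G N.P N.ident N.input t v =
      (alg.stateAt N.G N.P N.ident N.input t v, N.G.degree v, t,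
        fun _ _ => BitMessage.empty B) := by
    intro t
    induction t with
    | zero => intro _ v; rfl
    | succ t ih =>
      intro ht v
      have ht' : t < T := ht
      simp only [CongestAlgorithm.stateAt, ih ht'.le]
      simp [thenSend, ht']
  -- After `T + i` rounds the simulated state is frozen and the first `i` blocks from every port are
  -- stored.
  have phase2 : ∀ i ≤ r, ∀ v,
      (thenSend alg T r σ enc dec ρ).stateAt N.G N.P N.ident N.input (T + i) v =
      (alg.stateAt N.G N.P N.ident N.input T v, N.G.degree v, T + i, fun p j =>
        if hp : p < N.G.degree v ∧ j < i then
          enc (σ (f N (N.nbr v ⟨p, hp.1⟩)) (N.back v ⟨p, hp.1⟩)) j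
        else BitMessage.empty B) := by
    intro i
    induction i with
    | zero => intro _ v; simpa using phase1 T le_rfl v
    | succ i ih =>
      intro hi v
      have ih' := ih (Nat.le_of_succ_le hi)
      rw [← Nat.add_assoc]
      simp only [CongestAlgorithm.stateAt, ih']
      simp only [thenSend, Nat.not_lt.mpr (Nat.le_add_right T i), if_false, Nat.add_sub_cancel_left]
      refine Prod.ext rfl (Prod.ext rfl (Prod.ext rfl ?_))
      funext p j
      by_cases hp : p < N.G.degree v
      · rcases lt_trichotomy j i with hj | hj | hj
        · have h1 : j < i + 1 := by omega
          have h2 : j ≠ i := by omega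
          simp [hp, hj, h1, h2]
        · subst hj
          have := h N hN (N.nbr v ⟨p, hp⟩)
          simp only [CongestAlgorithm.outputAt] at this
          simp only [hp, and_self, dif_pos, lt_add_iff_pos_right, zero_lt_one]
          have h2 : alg.output (alg.stateAt N.G N.P N.ident N.input T (N.P v ⟨p, hp⟩).1) =
            f N (N.nbr v ⟨p, hp⟩) := this
          rw [h2]
          rfl
        · have h1 : ¬ j < i + 1 := by omega
          have h2 : j ≠ i := by omega
          have h3 : ¬ j < i := by omega
          simp [h1, h2, h3]
      · simp [hp]
  have key := phase2 r le_rfl v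
  have hv := h N hN v
  simp only [CongestAlgorithm.outputAt] at hv ⊢
  rw [key]
  simp only [thenSend, hv]
  congr 1
  funext p
  have hm : σ (f N (N.nbr v p)) (N.back v p) ∈ A :=
    hσ N hN _ _ (N.link_back v p).2.1
  rw [← hed _ hm]
  congr 1
  funext i
  by_cases hi : i < r <;> simp [hi]

end RoundComputable

/-- One round in which every node sends a message `μ s` to all its neighbors, where `s` is its
state, and computes its new state from its state and the received messages. -/
def bcast {V S M S' : Type} [Fintype V] (G : SimpleGraph V) [DecidableRel G.Adj] (μ : S → M)
    (g : S → Multiset M → S') (f : V → S) (v : V) : S' :=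
  g (f v) ((G.neighborFinset v).val.map fun u => μ (f u))

/-- Broadcasting makes ports irrelevant: the received messages matter only as a multiset over the
neighbors, so the list coloring can be analyzed on the graph alone. -/
theorem RoundComputable.bcast {B : ℕ} {I S S' M : Type} {Ω : Net I → Prop} {T : ℕ}
    {f : ∀ N : Net I, N.V → S} (hf : RoundComputable B Ω T f) (r : ℕ) (μ : S → M)
    (g : S → Multiset M → S') (A : Finset M) (hA : A.card ≤ 2 ^ (r * B))
    (hμ : ∀ N, Ω N → ∀ v, μ (f N v) ∈ A) :
    RoundComputable B Ω (T + r) (fun N => _root_.bcast N.G μ g (f N)) := by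
  refine (hf.exchange r (fun s _ => μ s)
    (fun d s m => g s ((Finset.univ : Finset (Fin d)).val.map m)) A hA
    (fun N hN v _ _ => hμ N hN v)).congr fun N _ v => ?_
  simp only [_root_.bcast]
  congr 1
  have : (N.G.neighborFinset v) = Finset.univ.map
      ((N.P v).toEmbedding.trans (Function.Embedding.subtype _)) := by
    ext u
    simp only [SimpleGraph.mem_neighborFinset, Finset.mem_map, Finset.mem_univ, true_and,
      Function.Embedding.trans_apply, Equiv.coe_toEmbedding, Function.Embedding.subtype_apply]
    constructor
    · intro hu
      exact ⟨(N.P v).symm ⟨u, hu⟩, by simp⟩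
    · rintro ⟨p, rfl⟩
      exact (N.P v p).2
  rw [this, Finset.map_val, Multiset.map_map]
  rfl

/-! ### Counting argument for candidate sets. -/

open Finset in
theorem card_filter_forall_mem {α γ : Type*} [Fintype α] [DecidableEq α] [Fintype γ]
    [DecidableEq γ] (U : Finset α) (E : Finset γ) :
    #{f : α → γ | ∀ a ∈ U, f a ∈ E} * Fintype.card γ ^ #U =
      #E ^ #U * Fintype.card γ ^ Fintype.card α := by
  have h : ({f : α → γ | ∀ a ∈ U, f a ∈ E} : Finset (α → γ)) =
      Fintype.piFinset (fun a => if a ∈ U then E else univ) := by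
    ext f
    simp only [mem_filter, mem_univ, true_and, Fintype.mem_piFinset]
    refine forall_congr' fun a => ?_
    by_cases ha : a ∈ U <;> simp [ha]
  rw [h, Fintype.card_piFinset]
  have h2 : ∀ a, #(if a ∈ U then E else univ) = if a ∈ U then #E else Fintype.card γ := by
    intro a; split_ifs <;> simp
  simp only [h2]
  rw [prod_ite]
  simp only [prod_const]
  have h3 : #({a | a ∈ U} : Finset α) = #U := by congr 1; ext; simp
  have h4 : #({a | a ∉ U} : Finset α) + #U = Fintype.card α := by
    rw [← h3, add_comm, card_filter_add_card_filter_not, card_univ]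
  rw [h3, ← h4, pow_add]
  ring

-- Union bound over the `n`-subsets of `W`: a random `f` maps a fixed one into `E` with probability
-- `(#E / #γ) ^ n`, and there are at most `#W ^ n` of them.
open Finset in
theorem card_filter_le_card_filter_mem {α γ : Type*} [Fintype α] [DecidableEq α] [Fintype γ]
    [DecidableEq γ] (W : Finset α) (E : Finset γ) (n : ℕ) :
    #{f : α → γ | n ≤ #{a ∈ W | f a ∈ E}} * Fintype.card γ ^ n ≤
      (#W * #E) ^ n * Fintype.card γ ^ Fintype.card α := by
  have hsub : ({f : α → γ | n ≤ #{a ∈ W | f a ∈ E}} : Finset (α → γ)) ⊆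
      (W.powersetCard n).biUnion fun U => {f : α → γ | ∀ a ∈ U, f a ∈ E} := by
    intro f hf
    simp only [mem_filter, mem_univ, true_and] at hf
    obtain ⟨U, hU, hc⟩ := exists_subset_card_eq hf
    simp only [mem_biUnion, mem_powersetCard, mem_filter, mem_univ, true_and]
    exact ⟨U, ⟨hU.trans (filter_subset _ _), hc⟩, fun a ha => (mem_filter.mp (hU ha)).2⟩
  calc _ ≤ (∑ U ∈ W.powersetCard n, #{f : α → γ | ∀ a ∈ U, f a ∈ E}) * Fintype.card γ ^ n :=
        Nat.mul_le_mul_right _ ((card_le_card hsub).trans card_biUnion_le)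
    _ = ∑ U ∈ W.powersetCard n, #E ^ n * Fintype.card γ ^ Fintype.card α := by
        rw [sum_mul]
        refine sum_congr rfl fun U hU => ?_
        have hc := (mem_powersetCard.mp hU).2
        have := card_filter_forall_mem U E
        rwa [hc] at this
    _ = (#W).choose n * #E ^ n * Fintype.card γ ^ Fintype.card α := by
        rw [sum_const, card_powersetCard, smul_eq_mul, mul_assoc]
    _ ≤ _ := by
        rw [mul_pow]
        gcongr
        exact Nat.choose_le_pow _ _

open Finset in
/-- If `p a b` holds for few `a`, whatever `b` is, then `p (h x) (h y)` holds for few `h`. -/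
theorem card_filter_apply_apply_mul_le {X A : Type*} [Fintype X] [DecidableEq X] [Fintype A]
    {p : A → A → Prop} [∀ a b, Decidable (p a b)] {c : ℕ}
    (hp : ∀ b, #{a | p a b} * c ≤ Fintype.card A) {x y : X} (hxy : x ≠ y) (hA : 0 < Fintype.card A) :
    #{h : X → A | p (h x) (h y)} * c ≤ Fintype.card (X → A) := by
  classical
  have e : #{h : X → A | p (h x) (h y)} * Fintype.card A =
      ∑ h : X → A, #{a | p a (h y)} := by
    have h1 : #{h : X → A | p (h x) (h y)} * Fintype.card A =
        #({w : (X → A) × A | p (w.1 x) (w.1 y)} : Finset ((X → A) × A)) := by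
      rw [← card_univ, ← card_product]
      congr 1
      ext w
      simp
    have h2 : ∑ h : X → A, #{a | p a (h y)} =
        #({w : (X → A) × A | p w.2 (w.1 y)} : Finset ((X → A) × A)) := by
      rw [← card_sigma]
      refine card_bij (fun s _ => (s.1, s.2)) ?_ ?_ ?_
      · intro s hs; simpa using hs
      · rintro ⟨a, b⟩ _ ⟨a', b'⟩ _ h; simpa using h
      · rintro ⟨a, b⟩ h; exact ⟨⟨a, b⟩, by simpa using h, rfl⟩
    rw [h1, h2]
    -- Swapping `h x` with an independent sample is a bijection, and it leaves `h y` alone because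
    -- `x ≠ y`; this expresses the independence of `h x` and `h y`.
    refine card_bij (fun w _ => (Function.update w.1 x w.2, w.1 x)) ?_ ?_ ?_
    · intro w hw
      simpa [Function.update_of_ne hxy.symm] using hw
    · rintro ⟨h, a⟩ _ ⟨h', a'⟩ _ hh
      simp only [Prod.mk.injEq] at hh
      have ha : a = a' := by simpa using congrFun hh.1 x
      refine Prod.ext (funext fun z => ?_) ha
      by_cases hz : z = x
      · subst hz; exact hh.2
      · simpa [Function.update_of_ne hz] using congrFun hh.1 z
    · rintro ⟨h, a⟩ hw
      refine ⟨(Function.update h x a, h x), ?_, ?_⟩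
      · simpa [Function.update_of_ne hxy.symm] using hw
      · simp
  refine Nat.le_of_mul_le_mul_right ?_ hA
  calc _ = (∑ h : X → A, #{a | p a (h y)}) * c := by rw [← e]; ring
    _ = ∑ h : X → A, #{a | p a (h y)} * c := sum_mul ..
    _ ≤ ∑ h : X → A, Fintype.card A := sum_le_sum fun h _ => hp (h y)
    _ = _ := by rw [sum_const, card_univ, smul_eq_mul]

open Finset in
/-- Every node with initial color `x` and list `L` has a family of candidate sets, indexed by `r`,
such that for all small sets of types of neighbors some candidate set has a small intersection
with all candidate sets of these neighbors. -/
theorem exists_candidates {X C : Type} [Fintype X] [Fintype C] {β τ ρ R : ℕ}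
    (hρ : Fintype.card X ^ 2 * 2 ^ Fintype.card C < 2 ^ ρ) (hR : β * ρ < R)
    (hτ : 2 * R ^ 2 * (β * τ + 1) ≤ 2 ^ τ) {s : ℕ} (hs : 2 * (β * τ + 1) * (β * τ) < s) :
    ∃ cand : X → Finset C → Fin R → Finset C,
      (∀ x L r, s ≤ #L → cand x L r ⊆ L ∧ #(cand x L r) = β * τ + 1) ∧
      ∀ x L, s ≤ #L → ∀ W : Finset (X × Finset C), #W ≤ β → (∀ w ∈ W, w.1 ≠ x ∧ s ≤ #w.2) →
        ∃ r, ∀ w ∈ W, ∀ r', ∀ D : Finset C, D ⊆ cand x L r → D ⊆ cand w.1 w.2 r' → #D ≤ τ := by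
  classical
  set k := β * τ + 1 with hk
  -- Each pair of an initial color and an index gets a random map `g` from colors to `2 * k` values.
  -- The candidate set consists of `k` colors of the list with the same value; the pigeonhole
  -- principle provides it as `s` exceeds `2 * k * (β * τ)`.
  let Q := Fin (2 * k)
  have hpick : ∀ (g : C → Q) (L : Finset C), ∃ D : Finset C, s ≤ #L →
      (D ⊆ L ∧ #D = k ∧ ∃ j, ∀ c ∈ D, g c = j) := by
    intro g L
    by_cases hL : s ≤ #L
    · have : #(univ : Finset Q) * (β * τ) < #L := by
        simpa [Q] using hs.trans_le hL
      obtain ⟨j, -, hj⟩ := exists_lt_card_fiber_of_mul_lt_card_of_maps_to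
        (f := g) (fun a _ => mem_univ _) this
      obtain ⟨D, hD, hc⟩ := exists_subset_card_eq (Nat.succ_le_of_lt hj)
      exact ⟨D, fun _ => ⟨hD.trans (filter_subset _ _), hc, j, fun c hc => (mem_filter.mp (hD hc)).2⟩⟩
    · exact ⟨∅, fun h => (hL h).elim⟩
  choose pick pick_spec using hpick
  -- The node's own candidate set lies in one fiber of `g`, so it suffices that every fiber of `g`
  -- meets the neighbor's set `W` in at most `τ` colors. This event does not involve the node's own
  -- list, so the union bound runs over the neighbor's lists only.
  let bad1 : Finset C → (C → Q) → Prop := fun W g => ∃ j, τ + 1 ≤ #{c ∈ W | g c ∈ ({j} : Finset Q)}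
  -- The probability is at most `2 * k * (k / (2 * k)) ^ (τ + 1) = k / 2 ^ τ`.
  have hcard1 : ∀ W : Finset C, #W = k →
      #{g | bad1 W g} * 2 ^ τ ≤ k * Fintype.card (C → Q) := by
    intro W hW
    have hsub : ({g | bad1 W g} : Finset (C → Q)) ⊆ (univ : Finset Q).biUnion fun j =>
        {g | τ + 1 ≤ #{c ∈ W | g c ∈ ({j} : Finset Q)}} := by
      intro g hg
      simpa [bad1] using hg
    have h1 : #{g | bad1 W g} * (2 * k) ^ (τ + 1) ≤ 2 * k * (k ^ (τ + 1) * Fintype.card (C → Q)) := by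
      calc _ ≤ (∑ j : Q, #{g : C → Q | τ + 1 ≤ #{c ∈ W | g c ∈ ({j} : Finset Q)}})
              * (2 * k) ^ (τ + 1) :=
            Nat.mul_le_mul_right _ ((card_le_card hsub).trans card_biUnion_le)
        _ = ∑ j : Q, #{g : C → Q | τ + 1 ≤ #{c ∈ W | g c ∈ ({j} : Finset Q)}}
              * (2 * k) ^ (τ + 1) := sum_mul ..
        _ ≤ ∑ j : Q, k ^ (τ + 1) * Fintype.card (C → Q) := by
            refine sum_le_sum fun j _ => ?_
            have := card_filter_le_card_filter_mem (γ := Q) W {j} (τ + 1)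
            simpa [Q, hW] using this
        _ = _ := by simp [Q]
    refine Nat.le_of_mul_le_mul_right ?_ (show 0 < 2 * k ^ (τ + 1) by positivity)
    calc _ = #{g | bad1 W g} * (2 * k) ^ (τ + 1) := by rw [mul_pow]; ring
      _ ≤ _ := h1
      _ = _ := by ring
  let bad2 : (Fin R → C → Q) → Finset C → (C → Q) → Prop :=
    fun h' L g => ∃ r', bad1 (pick (h' r') L) g
  have hcard2 : ∀ h' L, s ≤ #L → #{g | bad2 h' L g} * 2 ^ τ ≤ R * k * Fintype.card (C → Q) := by
    intro h' L hL
    have hsub : ({g | bad2 h' L g} : Finset (C → Q)) ⊆ (univ : Finset (Fin R)).biUnion fun r' =>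
        {g | bad1 (pick (h' r') L) g} := by
      intro g hg
      simpa [bad2] using hg
    calc _ ≤ (∑ r' : Fin R, #{g | bad1 (pick (h' r') L) g}) * 2 ^ τ :=
          Nat.mul_le_mul_right _ ((card_le_card hsub).trans card_biUnion_le)
      _ = ∑ r' : Fin R, #{g | bad1 (pick (h' r') L) g} * 2 ^ τ := sum_mul ..
      _ ≤ ∑ r' : Fin R, k * Fintype.card (C → Q) :=
          sum_le_sum fun r' _ => hcard1 _ (pick_spec _ _ hL).2.1
      _ = _ := by simp [mul_assoc]
  -- A neighbor type spoils `ρ` of the `R` independent indices only with probability at most `2 ^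
  -- (-ρ)`: a single index is spoiled with probability at most `R * k / 2 ^ τ ≤ 1 / (2 * R)`.
  let bad3 : Finset C → (Fin R → C → Q) → (Fin R → C → Q) → Prop :=
    fun L h h' => s ≤ #L ∧ ρ ≤ #{r ∈ (univ : Finset (Fin R)) | h r ∈ ({g | bad2 h' L g} : Finset (C → Q))}
  have hRpos : 0 < R := by omega
  have hcard3 : ∀ L h', #{h | bad3 L h h'} * 2 ^ ρ ≤ Fintype.card (Fin R → C → Q) := by
    intro L h'
    by_cases hL : s ≤ #L
    swap
    · simp [bad3, hL]
    simp only [bad3, hL, true_and]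
    set E : Finset (C → Q) := {g | bad2 h' L g} with hE
    set Z : Finset (Fin R → C → Q) := {h | ρ ≤ #{r ∈ (univ : Finset (Fin R)) | h r ∈ E}} with hZ
    set c := Fintype.card (C → Q) with hc
    have hcpos : 0 < c := by
      have : Nonempty Q := ⟨⟨0, by positivity⟩⟩
      exact Fintype.card_pos
    have h1 : #Z * c ^ ρ ≤ (R * #E) ^ ρ * Fintype.card (Fin R → C → Q) := by
      have := card_filter_le_card_filter_mem (univ : Finset (Fin R)) E ρ
      rw [card_univ, Fintype.card_fin] at this
      rw [Fintype.card_fun (α := Fin R), Fintype.card_fin]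
      exact this
    have h2 : R * #E * 2 ^ τ ≤ R * (R * k) * c := by
      have := Nat.mul_le_mul_left R (hcard2 h' L hL)
      calc _ = R * (#E * 2 ^ τ) := by ring
        _ ≤ _ := this
        _ = _ := by ring
    have h3 : R * #E * 2 ≤ c := by
      refine Nat.le_of_mul_le_mul_right ?_ (show 0 < R * (R * k) by positivity)
      calc _ = R * #E * (2 * R ^ 2 * k) := by ring
        _ ≤ R * #E * 2 ^ τ := Nat.mul_le_mul_left _ hτ
        _ ≤ _ := h2
        _ = _ := by ring
    refine Nat.le_of_mul_le_mul_right ?_ (show 0 < c ^ ρ by positivity)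
    calc _ = #Z * c ^ ρ * 2 ^ ρ := by ring
      _ ≤ (R * #E) ^ ρ * Fintype.card (Fin R → C → Q) * 2 ^ ρ := Nat.mul_le_mul_right _ h1
      _ = (R * #E * 2) ^ ρ * Fintype.card (Fin R → C → Q) := by rw [mul_pow _ 2]; ring
      _ ≤ c ^ ρ * Fintype.card (Fin R → C → Q) := by gcongr
      _ = _ := by ring
  have hHpos : 0 < Fintype.card (Fin R → C → Q) := by
    have : Nonempty Q := ⟨⟨0, by positivity⟩⟩
    exact Fintype.card_pos
  have hHpos' : 0 < Fintype.card (X → Fin R → C → Q) := by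
    have : Nonempty Q := ⟨⟨0, by positivity⟩⟩
    exact Fintype.card_pos
  -- Union bound over two distinct initial colors and the list of the neighbor: there are fewer than
  -- `2 ^ ρ` triples.
  obtain ⟨h, hh⟩ : ∃ h : X → Fin R → C → Q, ∀ x y L, x ≠ y → ¬ bad3 L (h x) (h y) := by
    by_contra! hcon
    let J : Finset (X × X × Finset C) := {w | w.1 ≠ w.2.1}
    have hcov : (univ : Finset (X → Fin R → C → Q)) ⊆ J.biUnion fun w =>
        {h | bad3 w.2.2 (h w.1) (h w.2.1)} := by
      intro h _
      obtain ⟨x, y, L, hxy, hb⟩ := hcon h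
      simp only [mem_biUnion, mem_filter, mem_univ, true_and, J]
      exact ⟨(x, y, L), hxy, hb⟩
    have h1 : Fintype.card (X → Fin R → C → Q) * 2 ^ ρ ≤
        #J * Fintype.card (X → Fin R → C → Q) := by
      calc _ ≤ (∑ w ∈ J, #{h : X → Fin R → C → Q | bad3 w.2.2 (h w.1) (h w.2.1)}) * 2 ^ ρ :=
            Nat.mul_le_mul_right _ ((card_le_card hcov).trans card_biUnion_le)
        _ = ∑ w ∈ J, #{h : X → Fin R → C → Q | bad3 w.2.2 (h w.1) (h w.2.1)} * 2 ^ ρ := sum_mul ..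
        _ ≤ ∑ w ∈ J, Fintype.card (X → Fin R → C → Q) := by
            refine sum_le_sum fun w hw => ?_
            exact card_filter_apply_apply_mul_le (hcard3 w.2.2) (by simpa [J] using hw) hHpos
        _ = _ := by rw [sum_const, smul_eq_mul]
    have h2 : #J ≤ Fintype.card X ^ 2 * 2 ^ Fintype.card C := by
      refine (card_le_univ _).trans_eq ?_
      rw [Fintype.card_prod, Fintype.card_prod, Fintype.card_finset]; ring
    have h3 : 2 ^ ρ ≤ #J := by
      refine Nat.le_of_mul_le_mul_left ?_ hHpos'
      rw [mul_comm _ #J]; exact h1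
    omega
  refine ⟨fun x L r => pick (h x r) L, fun x L r hL => ?_, fun x L hL W hW hWx => ?_⟩
  · have := pick_spec (h x r) L hL
    exact ⟨this.1, this.2.1⟩
  -- Each of the at most `β` neighbor types spoils fewer than `ρ` indices, and `β * ρ < R`.
  · obtain ⟨r, hr⟩ : ∃ r : Fin R, ∀ w ∈ W, ¬ bad2 (h w.1) w.2 (h x r) := by
      by_contra! hcon
      have hcov : (univ : Finset (Fin R)) ⊆ W.biUnion fun w =>
          {r | h x r ∈ ({g | bad2 (h w.1) w.2 g} : Finset (C → Q))} := by
        intro r _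
        obtain ⟨w, hw, hb⟩ := hcon r
        simp only [mem_biUnion, mem_filter, mem_univ, true_and]
        exact ⟨w, hw, hb⟩
      have : R ≤ β * ρ := by
        calc R = #(univ : Finset (Fin R)) := by simp
          _ ≤ ∑ w ∈ W, #{r | h x r ∈ ({g | bad2 (h w.1) w.2 g} : Finset (C → Q))} :=
            (card_le_card hcov).trans card_biUnion_le
          _ ≤ ∑ w ∈ W, ρ := by
            refine sum_le_sum fun w hw => ?_
            have h1 := hh x w.1 w.2 (hWx w hw).1.symm
            by_contra! hlt
            exact h1 ⟨(hWx w hw).2, hlt.le⟩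
          _ = #W * ρ := by rw [sum_const, smul_eq_mul]
          _ ≤ _ := Nat.mul_le_mul_right _ hW
      omega
    refine ⟨r, fun w hw r' D hD1 hD2 => ?_⟩
    obtain ⟨_, _, j, hj⟩ := pick_spec (h x r) L hL
    by_contra! hlt
    refine hr w hw ⟨r', j, (Nat.succ_le_of_lt hlt).trans (card_le_card fun c hc => ?_)⟩
    simp only [mem_filter, mem_singleton]
    exact ⟨hD2 hc, hj c (hD1 hc)⟩

/-! ### Polynomial codes. -/

open Finset Polynomial in
theorem card_filter_eval_eq_zero_le {F : Type*} [Field F] [Fintype F] [DecidableEq F] {p : F[X]}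
    {d : ℕ} (h0 : p ≠ 0) (hd : p.natDegree ≤ d) : #{t | p.eval t = 0} ≤ d := by
  have : ({t | p.eval t = 0} : Finset F) ⊆ p.roots.toFinset := by
    intro t ht
    simpa [h0] using ht
  exact (card_le_card this).trans ((Multiset.toFinset_card_le _).trans ((card_roots' p).trans hd))

open Finset Polynomial in
/-- Nonconstant polynomials of degree `d` give words such that two words agree in few places, and
every word takes every value in few places. -/
theorem exists_polynomial_code {Y : Type*} [Fintype Y] {q d : ℕ} (hq : q.Prime) (hd : 0 < d)
    (hY : Fintype.card Y ≤ q ^ d) :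
    ∃ ev : Y → Fin q → Fin q, (∀ x y, x ≠ y → #{t | ev x t = ev y t} ≤ d) ∧
      ∀ x c, #{t | ev x t = c} ≤ d := by
  classical
  have : Fact q.Prime := ⟨hq⟩
  obtain ⟨a⟩ : Nonempty (Y ↪ degreeLT (ZMod q) d) := by
    have e := (degreeLTEquiv (ZMod q) d).toEquiv
    obtain ⟨b⟩ : Nonempty (Y ↪ (Fin d → ZMod q)) :=
      Function.Embedding.nonempty_of_card_le (by simpa [ZMod.card] using hY)
    exact ⟨b.trans e.symm.toEmbedding⟩
  let e : Fin q ≃ ZMod q := Fintype.equivOfCardEq (by simp [ZMod.card])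
  -- The common term `X ^ d` makes every polynomial nonconstant, so that no value is taken often,
  -- and it cancels in differences.
  let p : Y → (ZMod q)[X] := fun x => X ^ d + (a x : (ZMod q)[X])
  have hcard : ∀ P : ZMod q → Prop, ∀ [DecidablePred P], #{t : Fin q | P (e t)} = #{t | P t} := by
    intro P _
    refine card_bij (fun t _ => e t) (by simp) (by simp) fun b hb => ⟨e.symm b, by simpa using hb⟩
  refine ⟨fun x t => e.symm ((p x).eval (e t)), fun x y hxy => ?_, fun x c => ?_⟩
  · simp only [EmbeddingLike.apply_eq_iff_eq]
    rw [hcard (fun t => (p x).eval t = (p y).eval t)]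
    have h0 : (a x : (ZMod q)[X]) - a y ≠ 0 := by
      rw [sub_ne_zero]
      exact fun h => hxy (a.injective (Subtype.ext h))
    have hdeg : ((a x : (ZMod q)[X]) - a y).natDegree ≤ d := by
      have := (degreeLT (ZMod q) d).sub_mem (a x).2 (a y).2
      exact natDegree_le_of_degree_le (mem_degreeLT.mp this).le
    refine le_trans (card_le_card fun t ht => ?_) (card_filter_eval_eq_zero_le h0 hdeg)
    simp only [mem_filter, mem_univ, true_and, p, eval_add, add_right_inj] at ht ⊢
    rw [eval_sub, ht, sub_self]
  · have h1 : ({t | e.symm ((p x).eval (e t)) = c} : Finset (Fin q)) =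
        ({t | (p x).eval (e t) = e c} : Finset (Fin q)) := by
      ext t; simp [Equiv.symm_apply_eq]
    rw [h1, hcard (fun t => (p x).eval t = e c)]
    have hlt : ((a x : (ZMod q)[X]) - Polynomial.C (e c)).degree < d := by
      refine (degree_sub_le _ _).trans_lt (max_lt (mem_degreeLT.mp (a x).2) ?_)
      exact degree_C_le.trans_lt (by exact_mod_cast hd)
    have hm : (X ^ d + ((a x : (ZMod q)[X]) - Polynomial.C (e c))).Monic := monic_X_pow_add hlt
    have hdeg : (X ^ d + ((a x : (ZMod q)[X]) - Polynomial.C (e c))).natDegree ≤ d := by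
      refine natDegree_le_of_degree_le ((degree_add_le _ _).trans (max_le ?_ hlt.le))
      exact degree_X_pow_le d
    refine le_trans (card_le_card fun t ht => ?_) (card_filter_eval_eq_zero_le hm.ne_zero hdeg)
    simp only [mem_filter, mem_univ, true_and, p] at ht ⊢
    rw [← add_sub_assoc, eval_sub, eval_C, ht, sub_self]

/-! ### Color reduction of Cole and Vishkin, two steps per exchange. -/

/-- Twice the least position at which the binary expansions of `a` and `b` differ, plus the digit of
`a` at this position. -/
noncomputable def firstDiff (a b : ℕ) : ℕ :=
  2 * sInf {k | a.testBit k ≠ b.testBit k} + (a.testBit (sInf {k | a.testBit k ≠ b.testBit k})).toNat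

/-- The color reduction step of Cole and Vishkin for a node of color `a` that has a successor of
color `b`, or no successor. -/
noncomputable def coleVishkin (a : ℕ) : Option ℕ → ℕ
  | some b => firstDiff a b
  | none => (a.testBit 0).toNat

theorem testBit_sInf_ne {a b : ℕ} (h : a ≠ b) :
    a.testBit (sInf {k | a.testBit k ≠ b.testBit k}) ≠
      b.testBit (sInf {k | a.testBit k ≠ b.testBit k}) := by
  refine Nat.sInf_mem (s := {k | a.testBit k ≠ b.testBit k}) ?_
  by_contra hne
  rw [Set.not_nonempty_iff_eq_empty, Set.eq_empty_iff_forall_notMem] at hne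
  exact h (Nat.eq_of_testBit_eq fun i => not_not.mp (hne i))

/-- Equal new colors would name the same position and the same digit of `a` and `b` there, but `a`
and `b` differ at the position named by `firstDiff a b`. Hence it does not matter what successor `b`
has. -/
theorem firstDiff_ne_coleVishkin {a b : ℕ} (h : a ≠ b) (o : Option ℕ) :
    firstDiff a b ≠ coleVishkin b o := by
  have hd := testBit_sInf_ne h
  intro he
  have split : ∀ {k k' : ℕ} {x x' : Bool}, 2 * k + x.toNat = 2 * k' + x'.toNat → k = k' ∧ x = x' := by
    intro k k' x x' hh
    cases x <;> cases x' <;> simp at hh ⊢ <;> omega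
  cases o with
  | none =>
    have : firstDiff a b = 2 * 0 + (b.testBit 0).toNat := by simpa [coleVishkin] using he
    obtain ⟨h1, h2⟩ := split this
    rw [h1] at hd h2
    exact hd h2
  | some c =>
    obtain ⟨h1, h2⟩ := split (show _ = _ from he)
    rw [← h1] at h2
    exact hd h2

theorem coleVishkin_lt {a l : ℕ} {o : Option ℕ} (hl : 0 < l) (ha : a < 2 ^ l)
    (ho : ∀ b ∈ o, b < 2 ^ l) : coleVishkin a o < 2 * l := by
  have toNat_le : ∀ x : Bool, x.toNat ≤ 1 := fun x => by cases x <;> simp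
  cases o with
  | none =>
    have := toNat_le (a.testBit 0)
    simp only [coleVishkin]; omega
  | some b =>
    simp only [coleVishkin, firstDiff]
    have h1 := toNat_le (a.testBit (sInf {k | a.testBit k ≠ b.testBit k}))
    have h2 : sInf {k | a.testBit k ≠ b.testBit k} < l := by
      -- For equal colors the set of positions is empty and its `sInf` is `0`.
      by_cases hab : a = b
      · simpa [hab] using hl
      · by_contra! hle
        have hd := testBit_sInf_ne hab
        have hpow := Nat.pow_le_pow_right (show 0 < 2 by norm_num) hle
        rw [Nat.testBit_lt_two_pow (ha.trans_le hpow),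
          Nat.testBit_lt_two_pow ((ho b rfl).trans_le hpow)] at hd
        exact hd rfl
    omega

/-- Two steps of Cole and Vishkin, the first one with respect to the successor and the second one
with respect to the predecessor. -/
noncomputable def doubleStep (a : ℕ) (out inn : Option ℕ) : ℕ :=
  coleVishkin (coleVishkin a out) (inn.map fun b => firstDiff b a)

/-- After the first step the color of the tail is `firstDiff a b`, which the head can compute as it
knows both colors. The second step therefore needs no further communication, and it preserves
properness for the reversed arc by the same argument. -/
theorem doubleStep_ne {a b : ℕ} (h : a ≠ b) (inn out : Option ℕ) :
    doubleStep a (some b) inn ≠ doubleStep b out (some a) :=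
  (firstDiff_ne_coleVishkin (firstDiff_ne_coleVishkin h out).symm _).symm

/-- The number of bits of the colors after `k` steps of Cole and Vishkin. -/
def cvBits (l : ℕ) : ℕ → ℕ
  | 0 => l
  | k + 1 => Nat.clog 2 (2 * cvBits l k)

theorem cvBits_pos {l : ℕ} (hl : 0 < l) (k : ℕ) : 0 < cvBits l k := by
  cases k with
  | zero => exact hl
  | succ k => exact Nat.clog_pos (by norm_num) (by have := cvBits_pos hl k; omega)

theorem coleVishkin_lt_two_pow {a l : ℕ} {o : Option ℕ} (hl : 0 < l) (ha : a < 2 ^ l)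
    (ho : ∀ b ∈ o, b < 2 ^ l) : coleVishkin a o < 2 ^ Nat.clog 2 (2 * l) :=
  (coleVishkin_lt hl ha ho).trans_le (Nat.le_pow_clog (by norm_num) _)

theorem doubleStep_lt {a l : ℕ} {out inn : Option ℕ} (hl : 0 < l) (ha : a < 2 ^ l)
    (ho : ∀ b ∈ out, b < 2 ^ l) (hi : ∀ b ∈ inn, b < 2 ^ l) :
    doubleStep a out inn < 2 ^ cvBits l 2 := by
  refine coleVishkin_lt_two_pow (cvBits_pos hl 1) (coleVishkin_lt_two_pow hl ha ho) ?_
  intro c hc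
  obtain ⟨b, hb, rfl⟩ := Option.mem_map.mp hc
  exact coleVishkin_lt_two_pow (o := some a) hl (hi b hb) (by rintro _ ⟨⟩; exact ha)

/-! ### Reduction on the graphs of all port pairs. -/

/-- The state of a node that knows for each of its ports the port of the neighbor behind it, and has
a color for each pair of ports.  The color for `(i, j)` is the color of the node in the graph of all
arcs that have port `i` at their tail and port `j` at their head. -/
structure PortState (I : Type) where
  input : I
  port : ℕ → ℕ
  color : ℕ → ℕ → ℕ

namespace PortState

variable {I : Type}

/-- The message sent through port `p`: the two colors that concern the edge behind it. -/
def msg (s : PortState I) (p : ℕ) : ℕ × ℕ := (s.color p (s.port p), s.color (s.port p) p)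

/-- The new state of a node that receives the messages `m`. -/
noncomputable def step (d : ℕ) (s : PortState I) (m : Fin d → ℕ × ℕ) : PortState I :=
  ⟨s.input, s.port, fun i j => doubleStep (s.color i j)
    (if h : i < d ∧ s.port i = j then some (m ⟨i, h.1⟩).2 else none)
    (if h : j < d ∧ s.port j = i then some (m ⟨j, h.1⟩).1 else none)⟩

/-- The states after `t` rounds. -/
noncomputable def run (N : Net I) : ℕ → N.V → PortState I
  | 0, v => ⟨N.input v, fun i => if h : i < N.G.degree v then N.back v ⟨i, h⟩ else 0,
      fun _ _ => N.ident v⟩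
  | t + 1, v => step (N.G.degree v) (run N t v) fun p => msg (run N t (N.nbr v p)) (N.back v p)

variable {N : Net I}

@[simp] theorem run_input (t : ℕ) (v : N.V) : (run N t v).input = N.input v := by
  induction t with
  | zero => rfl
  | succ t ih => exact ih

theorem run_port {v u : N.V} {i j : ℕ} (h : N.Link v i u j) (t : ℕ) : (run N t v).port i = j := by
  induction t with
  | zero => simp only [run, dif_pos h.1.1, h.back_eq h.1.1]
  | succ t ih => exact ih

theorem msg_run {v u : N.V} {i j : ℕ} (h : N.Link v i u j) (hi : i < N.G.degree v) (t : ℕ) :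
    msg (run N t (N.nbr v ⟨i, hi⟩)) (N.back v ⟨i, hi⟩) =
      ((run N t u).color j i, (run N t u).color i j) := by
  rw [h.back_eq hi, h.1.2, msg, run_port h.symm]

theorem run_color_ne (hid : Function.Injective N.ident) (t : ℕ) {v u : N.V} {i j : ℕ}
    (h : N.Link v i u j) : (run N t v).color i j ≠ (run N t u).color i j := by
  induction t with
  | zero =>
    simp only [run]
    have hadj : N.G.Adj v u := by
      obtain ⟨⟨h1, h2⟩, -⟩ := h
      exact h2 ▸ (N.P v ⟨i, h1⟩).2
    exact fun he => hadj.ne (hid he)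
  | succ t ih =>
    have h1 : i < N.G.degree v ∧ (run N t v).port i = j := ⟨h.1.1, run_port h t⟩
    have h2 : j < N.G.degree u ∧ (run N t u).port j = i := ⟨h.2.1, run_port h.symm t⟩
    simp only [run, step, dif_pos h1, dif_pos h2, msg_run h h1.1, msg_run h.symm h2.1]
    exact doubleStep_ne ih _ _

theorem run_color_lt {l : ℕ} (hl : 0 < l) (hid : ∀ v, N.ident v < 2 ^ l) (t : ℕ) (v : N.V)
    (i j : ℕ) : (run N t v).color i j < 2 ^ cvBits l (2 * t) := by
  induction t generalizing v i j with
  | zero => exact hid v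
  | succ t ih =>
    have e : cvBits l (2 * (t + 1)) = cvBits (cvBits l (2 * t)) 2 := rfl
    rw [e]
    refine doubleStep_lt (cvBits_pos hl _) (ih ..) ?_ ?_ <;>
    · intro b hb
      split_ifs at hb
      · rw [Option.mem_some_iff] at hb
        exact hb ▸ ih ..
      · exact (Option.not_mem_none _ hb).elim

-- A state has a color for every port pair, but only those for the two orientations of an edge cross
-- that edge. So exchange `i` carries two colors of `cvBits l (2 * i)` bits each. The initial `rp`
-- rounds are for the port numbers.
open Finset in
theorem computable_run {B l Δ rp : ℕ} {Ω : Net I → Prop} {r : ℕ → ℕ} (hl : 0 < l)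
    (hΩ : ∀ N, Ω N → (∀ v, N.G.degree v ≤ Δ) ∧ ∀ v, N.ident v < 2 ^ l)
    (hrp : Δ ≤ 2 ^ (rp * B)) (hr : ∀ i, 2 * cvBits l (2 * i) ≤ r i * B) (t : ℕ) :
    RoundComputable B Ω (rp + ∑ i ∈ range t, r i) (fun N v => run N t v) := by
  induction t with
  | zero =>
    have h0 : RoundComputable B Ω 0 (fun N v => (N.ident v, N.input v)) :=
      RoundComputable.init fun _ i x => (i, x)
    have h1 := h0.exchange rp (fun _ p => p)
      (fun d s m => (⟨s.2, fun i => if h : i < d then m ⟨i, h⟩ else 0, fun _ _ => s.1⟩ : PortState I))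
      (range Δ) (by simpa using hrp)
      (fun N hN v p hp => mem_range.mpr (hp.trans_le ((hΩ N hN).1 v)))
    rw [range_zero, sum_empty, add_zero]
    rw [zero_add] at h1
    exact h1
  | succ t ih =>
    rw [sum_range_succ, ← add_assoc]
    refine ih.exchange (r t) msg step
      (range (2 ^ cvBits l (2 * t)) ×ˢ range (2 ^ cvBits l (2 * t))) ?_ ?_
    · rw [card_product, card_range, ← pow_add]
      exact Nat.pow_le_pow_right (by norm_num) (by have := hr t; omega)
    · intro N hN v p _
      simp only [mem_product, mem_range, msg]
      exact ⟨run_color_lt hl (hΩ N hN).2 .., run_color_lt hl (hΩ N hN).2 ..⟩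

/-- The color composed of the colors for all edges of a node.  It has `Δ` digits less than
`Δ * 2 ^ W + 1` when the ports are less than `Δ` and the colors are less than `2 ^ W`. -/
def tuple (Δ W : ℕ) (d : ℕ) (s : PortState I) (i : Fin Δ) : Fin (Δ * 2 ^ W + 1) :=
  if i < d then Fin.ofNat _ (s.port i * 2 ^ W + s.color i (s.port i) + 1) else 0

/-- Let the edge have port `i` at `v` and port `j` at `u`. If the entries at position `i` agree,
then the port of `u` numbered `i` also has reverse port `j`, so both entries contain the colors of
`v` and `u` in the graph of `(i, j)`. The arc from `v` to `u` belongs to this graph, so these colors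
differ. The port `i` of `u` may lead to any node. -/
theorem tuple_run_ne (hid : Function.Injective N.ident) {Δ W t : ℕ}
    (hΔ : ∀ v, N.G.degree v ≤ Δ) (hW : ∀ v i j, (run N t v).color i j < 2 ^ W) {v u : N.V}
    (h : N.G.Adj v u) :
    tuple Δ W (N.G.degree v) (run N t v) ≠ tuple Δ W (N.G.degree u) (run N t u) := by
  obtain ⟨i, j, hl⟩ := N.exists_link h
  intro he
  have hi : i < N.G.degree v := hl.1.1
  have hj : j < Δ := hl.2.1.trans_le (hΔ u)
  have he := congrArg Fin.val (congrFun he ⟨i, hi.trans_le (hΔ v)⟩)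
  have bound : ∀ a c, a < Δ → c < 2 ^ W → a * 2 ^ W + c + 1 < Δ * 2 ^ W + 1 := by
    intro a c ha hc
    have := Nat.mul_le_mul_right (2 ^ W) (Nat.succ_le_of_lt ha)
    rw [Nat.succ_mul] at this
    omega
  simp only [tuple, hi, if_true, run_port hl] at he
  rw [Fin.val_ofNat, Nat.mod_eq_of_lt (bound _ _ hj (hW ..))] at he
  split_ifs at he with hu
  · have hp : (run N t u).port i < Δ := by
      have hb := N.link_back u ⟨i, hu⟩
      have := run_port hb t
      simp only at this
      rw [this]
      exact hb.2.1.trans_le (hΔ _)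
    rw [Fin.val_ofNat, Nat.mod_eq_of_lt (bound _ _ hp (hW ..))] at he
    have h1 := hW v i j
    have h2 := hW u i ((run N t u).port i)
    have hpos : 0 < 2 ^ W := by positivity
    have e1 : j = (run N t u).port i := by
      have d1 : (j * 2 ^ W + (run N t v).color i j) / 2 ^ W = j := by
        rw [mul_comm, Nat.mul_add_div hpos, Nat.div_eq_of_lt h1, add_zero]
      have d2 : ((run N t u).port i * 2 ^ W + (run N t u).color i ((run N t u).port i)) / 2 ^ W =
          (run N t u).port i := by
        rw [mul_comm, Nat.mul_add_div hpos, Nat.div_eq_of_lt h2, add_zero]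
      rw [← d1, ← d2]
      congr 1
      omega
    rw [← e1] at he
    exact run_color_ne hid t hl (by omega)
  · simp at he

end PortState

/-! ### Linial's step and the initial coloring. -/

open Finset in
/-- Linial's color reduction with a code whose words agree in at most `d` places. -/
theorem exists_linial {Y : Type} [Fintype Y] {q d Δ : ℕ} (ev : Y → Fin q → Fin q)
    (hev : ∀ x y, x ≠ y → #{t | ev x t = ev y t} ≤ d) (hq : Δ * d < q) :
    ∃ g : Y → Multiset Y → Fin q × Fin q, ∀ (V : Type) [Fintype V] (G : SimpleGraph V)
      [DecidableRel G.Adj] (y : V → Y), (∀ v, G.degree v ≤ Δ) → (∀ v u, G.Adj v u → y v ≠ y u) →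
      ∀ v u, G.Adj v u → bcast G id g y v ≠ bcast G id g y u := by
  classical
  have : Nonempty (Fin q) := ⟨⟨0, by omega⟩⟩
  let pick : Y → Multiset Y → Fin q :=
    fun y m => Classical.epsilon fun t => ∀ y' ∈ m, ev y t ≠ ev y' t
  refine ⟨fun y m => (pick y m, ev y (pick y m)), fun V _ G _ y hΔ hy => ?_⟩
  have spec : ∀ v, ∀ u ∈ G.neighborFinset v,
      ev (y v) (pick (y v) ((G.neighborFinset v).val.map y)) ≠
        ev (y u) (pick (y v) ((G.neighborFinset v).val.map y)) := by
    intro v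
    -- Each neighbor agrees with `v` in at most `d` of the `q > Δ * d` places, so some place
    -- separates `v` from all its neighbors.
    have hex : ∃ t, ∀ y' ∈ (G.neighborFinset v).val.map y, ev (y v) t ≠ ev y' t := by
      by_contra! hcon
      have hcov : (univ : Finset (Fin q)) ⊆ (G.neighborFinset v).biUnion fun u =>
          {t | ev (y v) t = ev (y u) t} := by
        intro t _
        obtain ⟨y', hy', he⟩ := hcon t
        obtain ⟨u, hu, rfl⟩ := Multiset.mem_map.mp hy'
        simp only [mem_biUnion, mem_filter, mem_univ, true_and]
        exact ⟨u, hu, he⟩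
      have : q ≤ Δ * d := by
        calc q = #(univ : Finset (Fin q)) := by simp
          _ ≤ ∑ u ∈ G.neighborFinset v, #{t | ev (y v) t = ev (y u) t} :=
            (card_le_card hcov).trans card_biUnion_le
          _ ≤ ∑ u ∈ G.neighborFinset v, d := sum_le_sum fun u hu =>
            hev _ _ (hy v u ((G.mem_neighborFinset v u).mp hu))
          _ = G.degree v * d := by simp
          _ ≤ _ := Nat.mul_le_mul_right _ (hΔ v)
      omega
    intro u hu
    exact Classical.epsilon_spec hex _ (Multiset.mem_map_of_mem y hu)
  intro v u h he
  have h1 := spec v u ((G.mem_neighborFinset v u).mpr h)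
  simp only [bcast, id_eq, Prod.mk.injEq] at he
  rw [he.2, ← he.1] at h1
  exact h1 rfl

open Finset in
/-- The coloring with `q ^ 2` colors computed from the identifiers. -/
theorem exists_computable_coloring {I : Type} {B l Δ rp rq t W q : ℕ} {Ω : Net I → Prop} {r : ℕ → ℕ}
    (hl : 0 < l) (hΩ : ∀ N, Ω N → (∀ v, N.G.degree v ≤ Δ) ∧ ValidIds l N.ident)
    (hrp : Δ ≤ 2 ^ (rp * B)) (hr : ∀ i, 2 * cvBits l (2 * i) ≤ r i * B)
    (hW : cvBits l (2 * t) ≤ W) (hrq : (Δ * 2 ^ W + 1) ^ Δ ≤ 2 ^ (rq * B)) (hΔ : 0 < Δ)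
    (hq : q.Prime) (hq1 : Δ * Δ < q) (hq2 : Δ * 2 ^ W + 1 ≤ q) :
    ∃ x : ∀ N : Net I, N.V → Fin q × Fin q,
      RoundComputable B Ω (rp + ∑ i ∈ range t, r i + rq) (fun N v => (N.input v, x N v)) ∧
      ∀ N, Ω N → ∀ v u, N.G.Adj v u → x N v ≠ x N u := by
  obtain ⟨ev, hev, -⟩ := exists_polynomial_code (Y := Fin Δ → Fin (Δ * 2 ^ W + 1)) hq hΔ
    (by simpa using Nat.pow_le_pow_left hq2 Δ)
  obtain ⟨g, hg⟩ := exists_linial ev hev hq1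
  let y : ∀ N : Net I, N.V → Fin Δ → Fin (Δ * 2 ^ W + 1) :=
    fun N v => PortState.tuple Δ W (N.G.degree v) (PortState.run N t v)
  refine ⟨fun N => bcast N.G id g (y N), ?_, fun N hN => hg N.V N.G (y N) (hΩ N hN).1 ?_⟩
  · have h0 := PortState.computable_run hl (fun N hN => ⟨(hΩ N hN).1, (hΩ N hN).2.2⟩) hrp hr t
    have h1 := h0.exchange 0 (fun _ _ => ()) (fun d s _ => (s.input, PortState.tuple Δ W d s)) univ
      (by simp) (fun _ _ _ _ _ => mem_univ _)
    have h2 := h1.bcast rq Prod.snd (fun s m => (s.1, g s.2 m)) univ (by simpa using hrq)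
      (fun _ _ _ => mem_univ _)
    exact h2.congr fun N _ v => Prod.ext (PortState.run_input t v) rfl
  · intro v u h
    refine PortState.tuple_run_ne (hΩ N hN).2.1 (hΩ N hN).1 (fun v i j => ?_) h
    exact (PortState.run_color_lt hl (hΩ N hN).2.2 t v i j).trans_le
      (Nat.pow_le_pow_right (by norm_num) hW)

/-! ### Steps of the list coloring algorithm. -/

/-- The state of a node of initial color `x` in the list coloring algorithm: the list `L` of
available colors, the final color `col`, the time and the class `cls` in the current decomposition
into classes of small outdegree, and the index `r` of the chosen candidate set. -/
@[ext] structure NodeState (X C : Type) (q R : ℕ) where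
  x : X
  L : Finset C
  col : Option C
  cls : Option (Fin q × Fin q)
  r : Fin R

namespace NodeState

variable {X C V : Type} {q R : ℕ} [Fintype V] (G : SimpleGraph V) [DecidableRel G.Adj]

/-- Execution of a list of steps in which every node sends its whole state to its neighbors. -/
def runSteps {S : Type} (steps : List (S → Multiset S → S)) (f : V → S) : V → S :=
  steps.foldl (fun f g => bcast G id g f) f

theorem runSteps_append {S : Type} (l l' : List (S → Multiset S → S)) (f : V → S) :
    runSteps G (l ++ l') f = runSteps G l' (runSteps G l f) := List.foldl_append

/-- Removal of the node from its class. -/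
def leaveClass (s : NodeState X C q R) (_ : Multiset (NodeState X C q R)) : NodeState X C q R :=
  { s with cls := none }

/-- The neighbor in state `u` prevents a node in state `s` from joining the class that the code `ev`
proposes at time `t`. -/
def Conflict (ev : X → Fin q → Fin q) (t : Fin q) (s u : NodeState X C q R) : Prop :=
  u.col = none ∧ ((∃ t', u.cls = some (t', ev s.x t)) ∨ (u.cls = none ∧ ev u.x t = ev s.x t))

open Classical in
/-- The node joins the class proposed at time `t` if it has at most `β` conflicts. -/
noncomputable def joinClass (ev : X → Fin q → Fin q) (β : ℕ) (t : Fin q) (s : NodeState X C q R)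
    (m : Multiset (NodeState X C q R)) : NodeState X C q R :=
  if s.col = none ∧ s.cls = none ∧ m.countP (Conflict ev t s) ≤ β then
    { s with cls := some (t, ev s.x t) } else s

/-- The node takes part in the coloring of class `c`. -/
def Active (sz : ℕ) (c : Fin q) (s : NodeState X C q R) : Prop :=
  s.col = none ∧ (∃ t, s.cls = some (t, c)) ∧ sz ≤ s.L.card

/-- The neighbor in state `u` is an active outneighbor of a node in state `s`. -/
def Out (sz : ℕ) (c : Fin q) (s u : NodeState X C q R) : Prop :=
  Active sz c u ∧ ∃ t t', s.cls = some (t, c) ∧ u.cls = some (t', c) ∧ t' ≤ t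

open Classical in
/-- An active node chooses a candidate set. -/
noncomputable def chooseSet [Nonempty (Fin R)] (cand : X → Finset C → Fin R → Finset C) (τ sz : ℕ)
    (c : Fin q) (s : NodeState X C q R) (m : Multiset (NodeState X C q R)) : NodeState X C q R :=
  if Active sz c s then
    { s with r := Classical.epsilon fun r => ∀ u ∈ m, Out sz c s u → ∀ r', ∀ D : Finset C,
        D ⊆ cand s.x s.L r → D ⊆ cand u.x u.L r' → D.card ≤ τ }
  else s

open Classical in
/-- An active node chooses a color from its candidate set. -/
noncomputable def chooseColor [Nonempty C] (cand : X → Finset C → Fin R → Finset C) (sz : ℕ)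
    (c : Fin q) (s : NodeState X C q R) (m : Multiset (NodeState X C q R)) : NodeState X C q R :=
  if Active sz c s then
    { s with col := some (Classical.epsilon fun a => a ∈ cand s.x s.L s.r ∧
        ∀ u ∈ m, Out sz c s u → a ∉ cand u.x u.L u.r) }
  else s

open Classical in
/-- An uncolored node removes the colors of its neighbors from its list. -/
noncomputable def updateList (s : NodeState X C q R) (m : Multiset (NodeState X C q R)) :
    NodeState X C q R :=
  if s.col = none then { s with L := s.L.filter fun a => ∀ u ∈ m, u.col ≠ some a } else s

/-- One stage of the algorithm: the decomposition into classes, and the coloring of the nodes with at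
least `sz` available colors, one class after the other. -/
noncomputable def stage [Nonempty C] [Nonempty (Fin R)] (ev : X → Fin q → Fin q)
    (cand : X → Finset C → Fin R → Finset C) (β τ sz : ℕ) :
    List (NodeState X C q R → Multiset (NodeState X C q R) → NodeState X C q R) :=
  leaveClass :: (List.finRange q).map (joinClass ev β) ++
    (List.finRange q).flatMap fun c => [chooseSet cand τ sz c, chooseColor cand sz c, updateList]

theorem length_stage [Nonempty C] [Nonempty (Fin R)] (ev : X → Fin q → Fin q)
    (cand : X → Finset C → Fin R → Finset C) (β τ sz : ℕ) :
    (stage ev cand β τ sz).length = 1 + 4 * q := by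
  simp [stage, List.length_flatMap]
  ring

/-- The state of the list coloring algorithm is consistent with the initial colors `x₀` and the
lists `L₀`. -/
structure Good (x₀ : V → X) (L₀ : V → Finset C) (f : V → NodeState X C q R) : Prop where
  x_eq : ∀ v, (f v).x = x₀ v
  subset : ∀ v, (f v).L ⊆ L₀ v
  mem : ∀ v a, (f v).col = some a → a ∈ L₀ v
  proper : ∀ v u a, G.Adj v u → (f v).col = some a → (f u).col ≠ some a
  avail : ∀ v u a, (f v).col = none → G.Adj v u → (f u).col = some a → a ∉ (f v).L
  card_lt : ∀ v, (f v).col = none →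
    ((G.neighborFinset v).filter fun u => (f u).col = none).card < (f v).L.card

variable {G}

/-! ### Decomposition into classes of small outdegree. -/

open Classical in
theorem countP_conflict (ev : X → Fin q → Fin q) (t : Fin q) (f : V → NodeState X C q R) (v : V) :
    ((G.neighborFinset v).val.map f).countP (Conflict ev t (f v)) =
      ((G.neighborFinset v).filter fun u => Conflict ev t (f v) (f u)).card := by
  rw [Multiset.countP_map]
  rfl

theorem joinClass_same (ev : X → Fin q → Fin q) (β : ℕ) (t : Fin q) (s : NodeState X C q R) (m) :
    (joinClass ev β t s m).x = s.x ∧ (joinClass ev β t s m).L = s.L ∧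
      (joinClass ev β t s m).col = s.col := by
  unfold joinClass
  split_ifs <;> simp

/-- Invariant of the decomposition into classes after the times in `ts`. -/
structure Decomposing (ev : X → Fin q → Fin q) (β : ℕ) (f₀ : V → NodeState X C q R)
    (ts : List (Fin q)) (f : V → NodeState X C q R) : Prop where
  same : ∀ v, (f v).x = (f₀ v).x ∧ (f v).L = (f₀ v).L ∧ (f v).col = (f₀ v).col
  time : ∀ v t c, (f v).cls = some (t, c) → t ∈ ts
  card_le : ∀ v t c, (f v).cls = some (t, c) → ∀ D : Finset V, D ⊆ G.neighborFinset v →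
    (∀ u ∈ D, (f u).col = none ∧ ∃ t' ≤ t, (f u).cls = some (t', c)) → D.card ≤ β
  le_sum : ∀ v, (f v).col = none → (f v).cls = none →
    (β + 1) * ts.length ≤ ∑ u ∈ G.neighborFinset v with (f u).col = none,
      (ts.countP (fun t => ev (f u).x t = ev (f v).x t) +
        (f u).cls.elim 0 fun w => ts.countP fun t => ev (f v).x t = w.2)

-- Outneighbors are members of the same class that joined no later. Their number is bounded at the
-- moment of joining and never grows, as later joiners do not count. A node that fails to join has
-- at least `β + 1` conflicts, each charged in `le_sum` to the neighbor that causes it.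
open Classical in
theorem Decomposing.step {ev : X → Fin q → Fin q} {β : ℕ} {f₀ f : V → NodeState X C q R}
    {ts : List (Fin q)} (h : Decomposing (G := G) ev β f₀ ts f) {t : Fin q} (ht : ∀ t' ∈ ts, t' < t) :
    Decomposing (G := G) ev β f₀ (ts ++ [t]) (bcast G id (joinClass ev β t) f) := by
  set f' := bcast G id (joinClass ev β t) f with hf'
  have same' : ∀ v, (f' v).x = (f v).x ∧ (f' v).L = (f v).L ∧ (f' v).col = (f v).col :=
    fun v => joinClass_same ..
  have cls' : ∀ v, (f' v).cls = (f v).cls ∨ ((f v).col = none ∧ (f v).cls = none ∧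
      (f' v).cls = some (t, ev (f v).x t) ∧
      ((G.neighborFinset v).filter fun u => Conflict ev t (f v) (f u)).card ≤ β) := by
    intro v
    simp only [hf', bcast, joinClass, id_eq]
    split_ifs with hc
    · right
      refine ⟨hc.1, hc.2.1, rfl, ?_⟩
      rw [← countP_conflict]
      exact hc.2.2
    · left; rfl
  have old : ∀ u t' c, (f' u).cls = some (t', c) → t' < t → (f u).cls = some (t', c) := by
    intro u t' c hu hlt
    rcases cls' u with h1 | ⟨-, -, h1, -⟩
    · exact h1 ▸ hu
    · rw [h1] at hu
      simp only [Option.some.injEq, Prod.mk.injEq] at hu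
      exact absurd hu.1.symm hlt.ne
  refine ⟨fun v => ?_, fun v t' c hv => ?_, fun v t' c hv D hD hDu => ?_, fun v hcol hcls => ?_⟩
  · have h1 := same' v
    have h2 := h.same v
    exact ⟨h1.1.trans h2.1, h1.2.1.trans h2.2.1, h1.2.2.trans h2.2.2⟩
  · rcases cls' v with h1 | ⟨-, -, h1, -⟩
    · exact List.mem_append_left _ (h.time v t' c (h1 ▸ hv))
    · rw [h1] at hv
      simp only [Option.some.injEq, Prod.mk.injEq] at hv
      simp [hv.1]
  · rcases cls' v with h1 | ⟨-, -, h1, hβ⟩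
    · rw [h1] at hv
      have hlt := ht t' (h.time v t' c hv)
      refine h.card_le v t' c hv D hD fun u hu => ?_
      obtain ⟨hu1, t'', hle, hu2⟩ := hDu u hu
      exact ⟨(same' u).2.2 ▸ hu1, t'', hle, old u t'' c hu2 (hle.trans_lt hlt)⟩
    · rw [h1] at hv
      simp only [Option.some.injEq, Prod.mk.injEq] at hv
      obtain ⟨rfl, rfl⟩ := hv
      -- An outneighbor of a node that joins now either was in the class before or joins now with
      -- the same proposal; both were counted as conflicts.
      refine le_trans (Finset.card_le_card fun u hu => ?_) hβ
      rw [Finset.mem_filter]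
      refine ⟨hD hu, ?_⟩
      obtain ⟨hu1, t'', hle, hu2⟩ := hDu u hu
      refine ⟨(same' u).2.2 ▸ hu1, ?_⟩
      rcases cls' u with h2 | ⟨-, h2, h3, -⟩
      · exact Or.inl ⟨t'', h2 ▸ hu2⟩
      · rw [h3] at hu2
        simp only [Option.some.injEq, Prod.mk.injEq] at hu2
        exact Or.inr ⟨h2, hu2.2⟩
  · have hcol0 : (f v).col = none := (same' v).2.2 ▸ hcol
    have hcls0 : (f v).cls = none := by
      rcases cls' v with h1 | ⟨-, h1, -, -⟩
      · exact h1 ▸ hcls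
      · exact h1
    have hconf : β + 1 ≤ ((G.neighborFinset v).filter fun u => Conflict ev t (f v) (f u)).card := by
      by_contra! hlt
      have : (f' v).cls = some (t, ev (f v).x t) := by
        simp only [hf', bcast, joinClass, id_eq, countP_conflict]
        rw [if_pos ⟨hcol0, hcls0, Nat.le_of_lt_succ hlt⟩]
      rw [this] at hcls
      exact Option.some_ne_none _ hcls
    have hold := h.le_sum v hcol0 hcls0
    have hU : (G.neighborFinset v).filter (fun u => Conflict ev t (f v) (f u)) =
        ((G.neighborFinset v).filter fun u => (f u).col = none).filter
          fun u => Conflict ev t (f v) (f u) := by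
      rw [Finset.filter_filter]
      exact Finset.filter_congr fun u _ => ⟨fun hu => ⟨hu.1, hu⟩, fun hu => hu.2⟩
    have hU' : ((G.neighborFinset v).filter fun u => (f' u).col = none) =
        (G.neighborFinset v).filter fun u => (f u).col = none :=
      Finset.filter_congr fun u _ => by rw [(same' u).2.2]
    rw [hU, Finset.card_filter] at hconf
    rw [hU', List.length_append, List.length_singleton, Nat.mul_add, mul_one]
    refine (Nat.add_le_add hold hconf).trans ?_
    rw [← Finset.sum_add_distrib]
    refine Finset.sum_le_sum fun u _ => ?_
    rw [(same' u).1, (same' v).1, List.countP_append]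
    simp only [List.countP_append, List.countP_singleton]
    have helim : ((f u).cls.elim 0 fun w => ts.countP fun t => decide (ev (f v).x t = w.2)) ≤
        (f' u).cls.elim 0 fun w => ts.countP fun t => decide (ev (f v).x t = w.2) := by
      rcases cls' u with h2 | ⟨-, h2, -, -⟩
      · rw [h2]
      · rw [h2]; exact Nat.zero_le _
    by_cases hc : Conflict ev t (f v) (f u)
    · rw [if_pos hc]
      rcases hc.2 with ⟨t', hu⟩ | ⟨hu, he⟩
      · have hu' : (f' u).cls = some (t', ev (f v).x t) := by
          rcases cls' u with h2 | ⟨-, h2, -, -⟩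
          · rw [h2, hu]
          · rw [hu] at h2; exact absurd h2 (Option.some_ne_none _)
        rw [hu, hu']
        simp
        omega
      · rw [hu]
        simp only [Option.elim_none, he, decide_true, if_true]
        omega
    · rw [if_neg hc]
      have : ((f' u).cls.elim 0 fun w => ts.countP fun t => decide (ev (f v).x t = w.2)) ≤
          (f' u).cls.elim 0 fun w => ts.countP (fun t => decide (ev (f v).x t = w.2)) +
            if decide (ev (f v).x t = w.2) = true then 1 else 0 := by
        cases (f' u).cls with
        | none => exact le_rfl
        | some w => exact Nat.le_add_right _ _
      omega

/-- All uncolored nodes are in classes, and have at most `β` uncolored outneighbors in their class. -/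
def Decomposed (G : SimpleGraph V) [DecidableRel G.Adj] (β : ℕ) (f : V → NodeState X C q R) : Prop :=
  ∀ v, (f v).col = none → ∃ t c, (f v).cls = some (t, c) ∧ ∀ D : Finset V, D ⊆ G.neighborFinset v →
    (∀ u ∈ D, (f u).col = none ∧ ∃ t' ≤ t, (f u).cls = some (t', c)) → D.card ≤ β

theorem Decomposing.run {ev : X → Fin q → Fin q} {β : ℕ} {f₀ : V → NodeState X C q R}
    (h : ∀ v, (f₀ v).cls = none) (ts : List (Fin q)) (hts : ts.Pairwise (· < ·)) :
    Decomposing (G := G) ev β f₀ ts (runSteps G (ts.map (joinClass ev β)) f₀) := by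
  induction ts using List.reverseRecOn with
  | nil =>
    refine ⟨fun v => ⟨rfl, rfl, rfl⟩, fun v t c hv => ?_, fun v t c hv => ?_, fun v _ _ => ?_⟩
    · exact absurd ((h v).symm.trans hv) (by simp)
    · exact absurd ((h v).symm.trans hv) (by simp)
    · simp
  | append_singleton ts t ih =>
    rw [List.pairwise_append] at hts
    rw [List.map_append, runSteps_append]
    exact (ih hts.1).step fun t' ht' => hts.2.2 t' ht' t (List.mem_singleton_self t)

open Finset in
theorem countP_finRange (p : Fin q → Prop) [DecidablePred p] :
    (List.finRange q).countP (fun t => p t) = #{t | p t} := by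
  rw [List.countP_eq_length_filter]
  rfl

-- A neighbor makes the same proposal at most `d` times, and its fixed class is proposed to `v` at
-- most `d` times, so at most `m` uncolored neighbors cause at most `2 * d * m` conflicts. A node
-- that never joins has at least `β + 1` of them at each of the `q` times, contradicting `hq`.
open Finset in
theorem decomposed_of_code {ev : X → Fin q → Fin q} {β d m : ℕ}
    (hev1 : ∀ x y, x ≠ y → #{t | ev x t = ev y t} ≤ d) (hev2 : ∀ x c, #{t | ev x t = c} ≤ d)
    (hq : 2 * d * m < q * (β + 1)) {x₀ : V → X} {f : V → NodeState X C q R}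
    (hx : ∀ v u, G.Adj v u → x₀ v ≠ x₀ u) (hf : ∀ v, (f v).x = x₀ v)
    (hm : ∀ v, (f v).col = none → #{u ∈ G.neighborFinset v | (f u).col = none} ≤ m) :
    ∀ f', f' = runSteps G (leaveClass :: (List.finRange q).map (joinClass ev β)) f →
    (∀ v, (f' v).x = (f v).x ∧ (f' v).L = (f v).L ∧ (f' v).col = (f v).col) ∧
      Decomposed G β f' := by
  intro f' hf'
  have hdec : Decomposing (G := G) ev β (bcast G id leaveClass f) (List.finRange q) f' := by
    rw [hf']
    exact Decomposing.run (fun v => rfl) _ (List.pairwise_lt_finRange q)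
  have same : ∀ v, (f' v).x = (f v).x ∧ (f' v).L = (f v).L ∧ (f' v).col = (f v).col := hdec.same
  refine ⟨same, fun v hv => ?_⟩
  cases hc : (f' v).cls with
  | some w => exact ⟨w.1, w.2, rfl, hdec.card_le v w.1 w.2 hc⟩
  | none =>
    exfalso
    have h1 := hdec.le_sum v hv hc
    have hU : ((G.neighborFinset v).filter fun u => (f' u).col = none) =
        (G.neighborFinset v).filter fun u => (f u).col = none :=
      filter_congr fun u _ => by rw [(same u).2.2]
    have h2 : ∀ u ∈ ((G.neighborFinset v).filter fun u => (f u).col = none),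
        ((List.finRange q).countP (fun t => ev (f' u).x t = ev (f' v).x t) +
          (f' u).cls.elim 0 fun w => (List.finRange q).countP fun t => ev (f' v).x t = w.2) ≤
        2 * d := by
      intro u hu
      rw [countP_finRange, two_mul]
      refine Nat.add_le_add (hev1 _ _ ?_) ?_
      · rw [(same u).1, (same v).1, hf, hf]
        exact (hx v u ((G.mem_neighborFinset v u).mp (mem_filter.mp hu).1)).symm
      · cases (f' u).cls with
        | none => exact Nat.zero_le _
        | some w =>
          simp only [Option.elim_some]
          rw [countP_finRange]
          exact hev2 _ _
    rw [List.length_finRange, hU] at h1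
    have h3 := h1.trans (sum_le_sum h2)
    rw [sum_const, smul_eq_mul] at h3
    have h4 := Nat.mul_le_mul_right (2 * d) (hm v ((same v).2.2 ▸ hv))
    have h5 := h3.trans h4
    rw [mul_comm m, mul_comm (β + 1)] at h5
    exact absurd h5 (not_le.mpr hq)

end NodeState

/-! ### Coloring one class. -/

namespace NodeState

variable {X C V : Type} {q R : ℕ} [Fintype V] {G : SimpleGraph V} [DecidableRel G.Adj]

/-- The candidate sets of nodes with at least `sz` available colors contain more than `β * τ` colors,
and can be chosen such that they have at most `τ` colors in common with the candidate sets of up to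
`β` neighbors. -/
structure IsCandidates (cand : X → Finset C → Fin R → Finset C) (β τ sz : ℕ) : Prop where
  subset : ∀ x L r, sz ≤ L.card → cand x L r ⊆ L ∧ (cand x L r).card = β * τ + 1
  exists_index : ∀ x L, sz ≤ L.card → ∀ W : Finset (X × Finset C), W.card ≤ β →
    (∀ w ∈ W, w.1 ≠ x ∧ sz ≤ w.2.card) →
    ∃ r, ∀ w ∈ W, ∀ r', ∀ D : Finset C, D ⊆ cand x L r → D ⊆ cand w.1 w.2 r' → D.card ≤ τ

open Classical in
theorem card_filter_out_le {β sz : ℕ} {f : V → NodeState X C q R} (hd : Decomposed G β f)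
    {c : Fin q} {v : V} (hv : Active sz c (f v)) :
    ((G.neighborFinset v).filter fun u => Out sz c (f v) (f u)).card ≤ β := by
  obtain ⟨t, c', hc, hD⟩ := hd v hv.1
  refine hD _ (Finset.filter_subset _ _) fun u hu => ?_
  obtain ⟨hu1, t1, t', ht1, ht', hle⟩ := (Finset.mem_filter.mp hu).2
  rw [hc] at ht1
  simp only [Option.some.injEq, Prod.mk.injEq] at ht1
  obtain ⟨rfl, rfl⟩ := ht1
  exact ⟨hu1.1, t', hle, ht'⟩

variable [Nonempty C] [Nonempty (Fin R)]

open Classical in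
/-- The three steps that color the active nodes of class `c`. -/
theorem exists_class_coloring {cand : X → Finset C → Fin R → Finset C} {β τ sz : ℕ}
    (hcand : IsCandidates cand β τ sz) {x₀ : V → X} (hx : ∀ v u, G.Adj v u → x₀ v ≠ x₀ u)
    {f : V → NodeState X C q R} (hf : ∀ v, (f v).x = x₀ v) (hd : Decomposed G β f) (c : Fin q) :
    ∃ (r : V → Fin R) (a : V → C),
      (bcast G id (chooseColor cand sz c) (bcast G id (chooseSet cand τ sz c) f) =
        fun v => if Active sz c (f v) then { f v with r := r v, col := some (a v) } else f v) ∧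
      (∀ v, Active sz c (f v) → a v ∈ (f v).L) ∧
      ∀ v u, G.Adj v u → Active sz c (f v) → Active sz c (f u) → a v ≠ a u := by
  set f₁ := bcast G id (chooseSet cand τ sz c) f with hf₁
  set f₂ := bcast G id (chooseColor cand sz c) f₁ with hf₂
  have same : ∀ v, (f₁ v).x = (f v).x ∧ (f₁ v).L = (f v).L ∧ (f₁ v).col = (f v).col ∧
      (f₁ v).cls = (f v).cls := by
    intro v
    simp only [hf₁, bcast, chooseSet]
    split_ifs <;> simp
  have hact : ∀ v, Active sz c (f₁ v) ↔ Active sz c (f v) := by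
    intro v
    simp only [Active, (same v).2.1, (same v).2.2.1, (same v).2.2.2]
  have hout : ∀ v u, Out sz c (f₁ v) (f₁ u) ↔ Out sz c (f v) (f u) := by
    intro v u
    simp only [Out, hact, (same v).2.2.2, (same u).2.2.2]
  have key1 : ∀ v, Active sz c (f v) → ∀ u ∈ G.neighborFinset v, Out sz c (f v) (f u) → ∀ r',
      ∀ D : Finset C, D ⊆ cand (f v).x (f v).L (f₁ v).r → D ⊆ cand (f u).x (f u).L r' →
      D.card ≤ τ := by
    intro v hv
    have hex : ∃ r, ∀ s ∈ (G.neighborFinset v).val.map f, Out sz c (f v) s → ∀ r',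
        ∀ D : Finset C, D ⊆ cand (f v).x (f v).L r → D ⊆ cand s.x s.L r' → D.card ≤ τ := by
      obtain ⟨r, hr⟩ := hcand.exists_index (f v).x (f v).L hv.2.2
        (((G.neighborFinset v).filter fun u => Out sz c (f v) (f u)).image
          fun u => ((f u).x, (f u).L))
        (Finset.card_image_le.trans (card_filter_out_le hd hv)) (by
          intro w hw
          obtain ⟨u, hu, rfl⟩ := Finset.mem_image.mp hw
          rw [Finset.mem_filter, SimpleGraph.mem_neighborFinset] at hu
          exact ⟨by rw [hf, hf]; exact (hx v u hu.1).symm, hu.2.1.2.2⟩)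
      refine ⟨r, fun s hs hsout => ?_⟩
      obtain ⟨u, hu, rfl⟩ := Multiset.mem_map.mp hs
      exact hr ((f u).x, (f u).L)
        (Finset.mem_image_of_mem _ (Finset.mem_filter.mpr ⟨hu, hsout⟩))
    intro u hu huo
    have hspec := Classical.epsilon_spec hex (f u) (Multiset.mem_map_of_mem f hu) huo
    have hr : (f₁ v).r = Classical.epsilon fun r => ∀ s ∈ (G.neighborFinset v).val.map f,
        Out sz c (f v) s → ∀ r', ∀ D : Finset C, D ⊆ cand (f v).x (f v).L r →
        D ⊆ cand s.x s.L r' → D.card ≤ τ := by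
      simp only [hf₁, bcast, chooseSet, id_eq]
      rw [if_pos hv]
    rw [hr]
    exact hspec
  have key2 : ∀ v, Active sz c (f v) → ∃ a, (f₂ v).col = some a ∧
      a ∈ cand (f v).x (f v).L (f₁ v).r ∧ ∀ u ∈ G.neighborFinset v, Out sz c (f v) (f u) →
        a ∉ cand (f u).x (f u).L (f₁ u).r := by
    intro v hv
    -- The at most `β` outneighbors block at most `τ` candidates each, and there are `β * τ + 1`
    -- candidates.
    have hex : ∃ a, a ∈ cand (f₁ v).x (f₁ v).L (f₁ v).r ∧ ∀ s ∈ (G.neighborFinset v).val.map f₁,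
        Out sz c (f₁ v) s → a ∉ cand s.x s.L s.r := by
      by_contra! hcon
      have hcov : cand (f₁ v).x (f₁ v).L (f₁ v).r ⊆
          ((G.neighborFinset v).filter fun u => Out sz c (f v) (f u)).biUnion fun u =>
            cand (f₁ v).x (f₁ v).L (f₁ v).r ∩ cand (f₁ u).x (f₁ u).L (f₁ u).r := by
        intro a ha
        obtain ⟨s, hs, hso, has⟩ := hcon a ha
        obtain ⟨u, hu, rfl⟩ := Multiset.mem_map.mp hs
        rw [Finset.mem_biUnion]
        exact ⟨u, Finset.mem_filter.mpr ⟨hu, (hout v u).mp hso⟩, Finset.mem_inter.mpr ⟨ha, has⟩⟩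
      have h1 := Finset.card_le_card hcov
      have h2 : ∀ u ∈ ((G.neighborFinset v).filter fun u => Out sz c (f v) (f u)),
          (cand (f₁ v).x (f₁ v).L (f₁ v).r ∩ cand (f₁ u).x (f₁ u).L (f₁ u).r).card ≤ τ := by
        intro u hu
        rw [Finset.mem_filter] at hu
        refine key1 v hv u hu.1 hu.2 (f₁ u).r _ ?_ ?_
        · rw [(same v).1, (same v).2.1]; exact Finset.inter_subset_left
        · rw [(same u).1, (same u).2.1]; exact Finset.inter_subset_right
      have h3 := h1.trans (Finset.card_biUnion_le_card_mul _ _ _ h2)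
      rw [(hcand.subset _ _ _ ((hact v).mpr hv).2.2).2] at h3
      have h4 := Nat.mul_le_mul_right τ (card_filter_out_le hd hv)
      omega
    obtain ⟨a, ha, hspec⟩ : ∃ a, (f₂ v).col = some a ∧ a ∈ cand (f₁ v).x (f₁ v).L (f₁ v).r ∧
        ∀ s ∈ (G.neighborFinset v).val.map f₁, Out sz c (f₁ v) s → a ∉ cand s.x s.L s.r := by
      refine ⟨_, ?_, Classical.epsilon_spec hex⟩
      simp only [hf₂, bcast, chooseColor, id_eq]
      rw [if_pos ((hact v).mpr hv)]
    refine ⟨a, ha, ?_, ?_⟩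
    · have := hspec.1
      rwa [(same v).1, (same v).2.1] at this
    · intro u hu huo
      have := hspec.2 (f₁ u) (Multiset.mem_map_of_mem f₁ hu) ((hout v u).mpr huo)
      rwa [(same u).1, (same u).2.1] at this
  have key3 : ∀ v, ∃ a, Active sz c (f v) → (f₂ v).col = some a ∧
      a ∈ cand (f v).x (f v).L (f₁ v).r ∧ ∀ u ∈ G.neighborFinset v, Out sz c (f v) (f u) →
        a ∉ cand (f u).x (f u).L (f₁ u).r := by
    intro v
    by_cases hv : Active sz c (f v)
    · obtain ⟨a, ha⟩ := key2 v hv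
      exact ⟨a, fun _ => ha⟩
    · exact ⟨Classical.arbitrary C, fun h => (hv h).elim⟩
  choose a ha using key3
  refine ⟨fun v => (f₁ v).r, a, ?_, fun v hv => ?_, fun v u hvu hv hu => ?_⟩
  · funext v
    by_cases hv : Active sz c (f v)
    · rw [if_pos hv]
      have h1 := (ha v hv).1
      have hx2 : (f₂ v).x = (f₁ v).x ∧ (f₂ v).L = (f₁ v).L ∧ (f₂ v).cls = (f₁ v).cls ∧
          (f₂ v).r = (f₁ v).r := by
        simp only [hf₂, bcast, chooseColor]
        split_ifs <;> simp
      ext1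
      · rw [hx2.1, (same v).1]
      · rw [hx2.2.1, (same v).2.1]
      · exact h1
      · rw [hx2.2.2.1, (same v).2.2.2]
      · exact hx2.2.2.2
    · rw [if_neg hv]
      simp only [hf₂, bcast, chooseColor, id_eq]
      rw [if_neg (fun h => hv ((hact v).mp h))]
      simp only [hf₁, bcast, chooseSet, id_eq]
      rw [if_neg hv]
  · exact (hcand.subset _ _ _ hv.2.2).1 (ha v hv).2.1
  · obtain ⟨t, htv⟩ := hv.2.1
    obtain ⟨t', htu⟩ := hu.2.1
    intro he
    -- The node that joined no earlier has the other one as an outneighbor, so its color avoids the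
    -- whole candidate set that contains the color of the other one.
    rcases le_total t' t with hle | hle
    · exact (ha v hv).2.2 u ((G.mem_neighborFinset v u).mpr hvu) ⟨hu, t, t', htv, htu, hle⟩
        (he ▸ (ha u hu).2.1)
    · exact (ha u hu).2.2 v ((G.mem_neighborFinset u v).mpr hvu.symm) ⟨hv, t', t, htu, htv, hle⟩
        (he ▸ (ha v hv).2.1)

/-- The effect of the steps that color the active nodes of class `c`. -/
theorem Good.colorClass {cand : X → Finset C → Fin R → Finset C} {β τ sz : ℕ}
    (hcand : IsCandidates cand β τ sz) {x₀ : V → X} (hx : ∀ v u, G.Adj v u → x₀ v ≠ x₀ u)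
    {L₀ : V → Finset C} {f : V → NodeState X C q R} (hf : Good G x₀ L₀ f) (hd : Decomposed G β f)
    (c : Fin q) :
    ∀ f', f' = runSteps G [chooseSet cand τ sz c, chooseColor cand sz c, updateList] f →
    Good G x₀ L₀ f' ∧ ∀ v, (f' v).cls = (f v).cls ∧ (f' v).L ⊆ (f v).L ∧
      ((f' v).col = none → (f v).col = none ∧ ¬ Active sz c (f v)) := by
  classical
  intro f' hf'
  obtain ⟨r, a, h2, haL, haa⟩ := exists_class_coloring hcand hx hf.x_eq hd c
  set f₂ := bcast G id (chooseColor cand sz c) (bcast G id (chooseSet cand τ sz c) f) with hf₂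
  have hf'2 : f' = bcast G id updateList f₂ := hf'
  have e2 : ∀ v, f₂ v = if Active sz c (f v) then { f v with r := r v, col := some (a v) } else f v :=
    fun v => congrFun h2 v
  have x2 : ∀ v, (f₂ v).x = (f v).x ∧ (f₂ v).L = (f v).L ∧ (f₂ v).cls = (f v).cls := by
    intro v; rw [e2]; split_ifs <;> simp
  have col2a : ∀ v, Active sz c (f v) → (f₂ v).col = some (a v) := by
    intro v hv; rw [e2, if_pos hv]
  have col2b : ∀ v, ¬ Active sz c (f v) → (f₂ v).col = (f v).col := by
    intro v hv; rw [e2, if_neg hv]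
  have col2n : ∀ v, (f₂ v).col = none → (f v).col = none ∧ ¬ Active sz c (f v) := by
    intro v hv
    by_cases hA : Active sz c (f v)
    · rw [col2a v hA] at hv; exact (Option.some_ne_none _ hv).elim
    · exact ⟨col2b v hA ▸ hv, hA⟩
  have x3 : ∀ v, (f' v).x = (f₂ v).x ∧ (f' v).col = (f₂ v).col ∧ (f' v).cls = (f₂ v).cls := by
    intro v
    simp only [hf'2, bcast, updateList]
    split_ifs <;> simp
  have L3 : ∀ v, (f' v).L ⊆ (f₂ v).L := by
    intro v
    simp only [hf'2, bcast, updateList]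
    split_ifs
    · exact Finset.filter_subset _ _
    · exact subset_rfl
  have L3n : ∀ v, (f₂ v).col = none → (f' v).L = (f v).L.filter fun b =>
      ∀ s ∈ (G.neighborFinset v).val.map f₂, s.col ≠ some b := by
    intro v hv
    rw [← (x2 v).2.1]
    simp only [hf'2, bcast, updateList, id_eq]
    rw [if_pos hv]
  refine ⟨⟨fun v => ?_, fun v => ?_, fun v b hv => ?_, fun v u b hvu hv hu => ?_,
    fun v u b hv hvu hu hb => ?_, fun v hv => ?_⟩, fun v => ⟨?_, ?_, fun hv => ?_⟩⟩
  · rw [(x3 v).1, (x2 v).1, hf.x_eq]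
  · exact (L3 v).trans ((x2 v).2.1 ▸ hf.subset v)
  · rw [(x3 v).2.1] at hv
    by_cases hA : Active sz c (f v)
    · rw [col2a v hA, Option.some.injEq] at hv
      exact hv ▸ hf.subset v (haL v hA)
    · rw [col2b v hA] at hv
      exact hf.mem v b hv
  · rw [(x3 v).2.1] at hv
    rw [(x3 u).2.1] at hu
    by_cases hA : Active sz c (f v) <;> by_cases hB : Active sz c (f u)
    · rw [col2a v hA, Option.some.injEq] at hv
      rw [col2a u hB, Option.some.injEq] at hu
      exact haa v u hvu hA hB (hv.trans hu.symm)
    · rw [col2a v hA, Option.some.injEq] at hv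
      rw [col2b u hB] at hu
      exact hf.avail v u b hA.1 hvu hu (hv ▸ haL v hA)
    · rw [col2b v hA] at hv
      rw [col2a u hB, Option.some.injEq] at hu
      exact hf.avail u v b hB.1 hvu.symm hv (hu ▸ haL u hB)
    · rw [col2b v hA] at hv
      rw [col2b u hB] at hu
      exact hf.proper v u b hvu hv hu
  · rw [(x3 v).2.1] at hv
    rw [(x3 u).2.1] at hu
    rw [L3n v hv, Finset.mem_filter] at hb
    exact hb.2 (f₂ u) (Multiset.mem_map_of_mem f₂ ((G.mem_neighborFinset v u).mpr hvu)) hu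
  · rw [(x3 v).2.1] at hv
    obtain ⟨hv0, -⟩ := col2n v hv
    have hold := hf.card_lt v hv0
    have hnew : ((G.neighborFinset v).filter fun u => (f' u).col = none) =
        (G.neighborFinset v).filter fun u => (f₂ u).col = none :=
      Finset.filter_congr fun u _ => by rw [(x3 u).2.1]
    rw [hnew]
    have hsplit : ((G.neighborFinset v).filter fun u => (f₂ u).col = none) ∪
        ((G.neighborFinset v).filter fun u => Active sz c (f u)) ⊆
        (G.neighborFinset v).filter fun u => (f u).col = none := by
      intro u hu
      rw [Finset.mem_union, Finset.mem_filter, Finset.mem_filter] at hu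
      rw [Finset.mem_filter]
      rcases hu with hu | hu
      · exact ⟨hu.1, (col2n u hu.2).1⟩
      · exact ⟨hu.1, hu.2.1⟩
    have hdisj : Disjoint ((G.neighborFinset v).filter fun u => (f₂ u).col = none)
        ((G.neighborFinset v).filter fun u => Active sz c (f u)) := by
      rw [Finset.disjoint_filter]
      exact fun u _ hu => (col2n u hu).2
    have h1 := Finset.card_le_card hsplit
    rw [Finset.card_union_of_disjoint hdisj] at h1
    -- The list of `v` loses at most one color per active neighbor, and each active neighbor leaves
    -- the set of uncolored neighbors, so the surplus in `card_lt` is kept.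
    have hL : (f v).L ⊆ (f' v).L ∪
        ((G.neighborFinset v).filter fun u => Active sz c (f u)).image a := by
      intro b hb
      rw [Finset.mem_union, L3n v hv, Finset.mem_filter, Finset.mem_image]
      by_cases hcon : ∀ s ∈ (G.neighborFinset v).val.map f₂, s.col ≠ some b
      · exact Or.inl ⟨hb, hcon⟩
      · right
        push Not at hcon
        obtain ⟨s, hs, hsb⟩ := hcon
        obtain ⟨u, hu, rfl⟩ := Multiset.mem_map.mp hs
        have hu' : u ∈ G.neighborFinset v := hu
        by_cases hA : Active sz c (f u)
        · refine ⟨u, Finset.mem_filter.mpr ⟨hu', hA⟩, ?_⟩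
          rw [col2a u hA, Option.some.injEq] at hsb
          exact hsb
        · rw [col2b u hA] at hsb
          exact (hf.avail v u b hv0 ((G.mem_neighborFinset v u).mp hu') hsb hb).elim
    have h2 := (Finset.card_le_card hL).trans (Finset.card_union_le _ _)
    have h3 := Finset.card_image_le
      (s := (G.neighborFinset v).filter fun u => Active sz c (f u)) (f := a)
    omega
  · rw [(x3 v).2.2, (x2 v).2.2]
  · rw [← (x2 v).2.1]; exact L3 v
  · exact col2n v ((x3 v).2.1 ▸ hv)

end NodeState

/-! ### Halving stages and the size of the messages. -/

namespace NodeState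

variable {X C V : Type} {q R : ℕ} [Fintype V] {G : SimpleGraph V} [DecidableRel G.Adj]

theorem Decomposed.mono {β : ℕ} {f f' : V → NodeState X C q R} (hd : Decomposed G β f)
    (hcls : ∀ v, (f' v).cls = (f v).cls) (hcol : ∀ v, (f' v).col = none → (f v).col = none) :
    Decomposed G β f' := by
  intro v hv
  obtain ⟨t, c, hc, hD⟩ := hd v (hcol v hv)
  refine ⟨t, c, (hcls v).trans hc, fun D hDv hDu => hD D hDv fun u hu => ?_⟩
  obtain ⟨h1, t', hle, h2⟩ := hDu u hu
  exact ⟨hcol u h1, t', hle, hcls u ▸ h2⟩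

/-- The number of states with at most `M` available colors is small. -/
theorem exists_finset_states [Fintype X] [Fintype C] (M : ℕ) :
    ∃ A : Finset (NodeState X C q R), (∀ s, s.L.card ≤ M → s ∈ A) ∧
      A.card ≤ Fintype.card X * (Fintype.card C + 1) ^ M * (Fintype.card C + 1) * (q * q + 1) * R := by
  classical
  let F : X × (Fin M → Option C) × Option C × Option (Fin q × Fin q) × Fin R → NodeState X C q R :=
    fun w => ⟨w.1, Finset.univ.filter fun c => ∃ i, w.2.1 i = some c, w.2.2.1, w.2.2.2.1, w.2.2.2.2⟩
  refine ⟨Finset.univ.image F, fun s hs => ?_, Finset.card_image_le.trans_eq ?_⟩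
  · rw [Finset.mem_image]
    -- A list of at most `M` colors is enumerated and padded with `none`.
    refine ⟨(s.x, fun i => s.L.toList[i.1]?, s.col, s.cls, s.r), Finset.mem_univ _, ?_⟩
    ext1 <;> try rfl
    ext c
    simp only [F, Finset.mem_filter, Finset.mem_univ, true_and]
    rw [← Finset.mem_toList, List.mem_iff_getElem?]
    constructor
    · rintro ⟨i, hi⟩; exact ⟨i, hi⟩
    · rintro ⟨i, hi⟩
      have := (List.getElem?_eq_some_iff.mp hi).1
      rw [Finset.length_toList] at this
      exact ⟨⟨i, this.trans_le hs⟩, hi⟩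
  · rw [Finset.card_univ]
    simp only [Fintype.card_prod, Fintype.card_fun, Fintype.card_fin, Fintype.card_option]
    ring

variable [Nonempty C] [Nonempty (Fin R)]

theorem Good.colorClasses {cand : X → Finset C → Fin R → Finset C} {β τ sz : ℕ}
    (hcand : IsCandidates cand β τ sz) {x₀ : V → X} (hx : ∀ v u, G.Adj v u → x₀ v ≠ x₀ u)
    {L₀ : V → Finset C} {f : V → NodeState X C q R} (hf : Good G x₀ L₀ f) (hd : Decomposed G β f)
    (cs : List (Fin q)) :
    ∀ f', f' = runSteps G (cs.flatMap fun c =>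
      [chooseSet cand τ sz c, chooseColor cand sz c, updateList]) f →
    Good G x₀ L₀ f' ∧ ∀ v, (f' v).cls = (f v).cls ∧ (f' v).L ⊆ (f v).L ∧
      ((f' v).col = none → (f v).col = none ∧ ∀ c ∈ cs, (∃ t, (f v).cls = some (t, c)) →
        (f' v).L.card < sz) := by
  induction cs using List.reverseRecOn with
  | nil =>
    rintro f' rfl
    exact ⟨hf, fun v => ⟨rfl, subset_rfl, fun h => ⟨h, fun c hc => (List.not_mem_nil hc).elim⟩⟩⟩
  | append_singleton cs c ih =>
    intro f' hf'
    rw [List.flatMap_append, runSteps_append, List.flatMap_singleton] at hf'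
    obtain ⟨hg, hs⟩ := ih _ rfl
    have hd' := hd.mono (fun v => (hs v).1) (fun v hv => ((hs v).2.2 hv).1)
    obtain ⟨hg', hs'⟩ := hg.colorClass hcand hx hd' c f' hf'
    refine ⟨hg', fun v => ⟨(hs' v).1.trans (hs v).1, (hs' v).2.1.trans (hs v).2.1, fun hv => ?_⟩⟩
    obtain ⟨h1, h2⟩ := (hs' v).2.2 hv
    obtain ⟨h3, h4⟩ := (hs v).2.2 h1
    refine ⟨h3, fun c' hc' hcls => ?_⟩
    refine (Finset.card_le_card (hs' v).2.1).trans_lt ?_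
    rcases List.mem_append.mp hc' with hc' | hc'
    · exact h4 c' hc' hcls
    · rw [List.mem_singleton] at hc'
      subst hc'
      by_contra! hlt
      obtain ⟨t, ht⟩ := hcls
      exact h2 ⟨h1, ⟨t, (hs v).1.trans ht⟩, hlt⟩

-- Every uncolored node is in some class. If it is still uncolored after its class was treated, it
-- was inactive at that time, so it had fewer than `sz` available colors. The surplus `card_lt`
-- bounds the number of uncolored neighbors by `m`, as the decomposition requires.
open Finset in
theorem Good.stage {ev : X → Fin q → Fin q} {cand : X → Finset C → Fin R → Finset C}
    {β τ sz d m : ℕ} (hev1 : ∀ x y, x ≠ y → #{t | ev x t = ev y t} ≤ d)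
    (hev2 : ∀ x c, #{t | ev x t = c} ≤ d) (hq : 2 * d * m < q * (β + 1))
    (hcand : IsCandidates cand β τ sz) {x₀ : V → X} (hx : ∀ v u, G.Adj v u → x₀ v ≠ x₀ u)
    {L₀ : V → Finset C} {f : V → NodeState X C q R} (hf : Good G x₀ L₀ f)
    (hm : ∀ v, (f v).col = none → #(f v).L ≤ m) :
    ∀ f', f' = runSteps G (stage ev cand β τ sz) f →
    Good G x₀ L₀ f' ∧ ∀ v, (f' v).col = none → #(f' v).L < sz := by
  intro f' hf'
  rw [NodeState.stage, runSteps_append] at hf'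
  obtain ⟨same, hd⟩ := decomposed_of_code hev1 hev2 hq hx hf.x_eq
    (fun v hv => (hf.card_lt v hv).le.trans (hm v hv)) _ rfl
  set f₁ := runSteps G (leaveClass :: (List.finRange q).map (joinClass ev β)) f with hf₁
  have hg : Good G x₀ L₀ f₁ := by
    refine ⟨fun v => ?_, fun v => ?_, fun v a => ?_, fun v u a => ?_, fun v u a => ?_, fun v => ?_⟩
    · rw [(same v).1, hf.x_eq]
    · rw [(same v).2.1]; exact hf.subset v
    · rw [(same v).2.2]; exact hf.mem v a
    · rw [(same v).2.2, (same u).2.2]; exact hf.proper v u a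
    · rw [(same v).2.2, (same u).2.2, (same v).2.1]; exact hf.avail v u a
    · rw [(same v).2.2, (same v).2.1]
      have : ((G.neighborFinset v).filter fun u => (f₁ u).col = none) =
          (G.neighborFinset v).filter fun u => (f u).col = none :=
        filter_congr fun u _ => by rw [(same u).2.2]
      rw [this]
      exact hf.card_lt v
  obtain ⟨hg', hs⟩ := hg.colorClasses hcand hx hd (List.finRange q) f' hf'
  refine ⟨hg', fun v hv => ?_⟩
  obtain ⟨h1, h2⟩ := (hs v).2.2 hv
  obtain ⟨t, c, hc, -⟩ := hd v h1
  exact h2 c (List.mem_finRange c) ⟨t, hc⟩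

/-- The stages of the algorithm for lists of at most `M` colors.  The number of available colors of
uncolored nodes is halved in each stage. -/
noncomputable def stages (ev : X → Fin q → Fin q) (cand : ℕ → X → Finset C → Fin R → Finset C)
    (d τ M k : ℕ) : List (NodeState X C q R → Multiset (NodeState X C q R) → NodeState X C q R) :=
  (List.range k).flatMap fun i =>
    stage ev (cand (M / 2 ^ i)) (2 * d * (M / 2 ^ i) / q) τ (M / 2 ^ i / 2 + 1)

theorem length_stages (ev : X → Fin q → Fin q) (cand : ℕ → X → Finset C → Fin R → Finset C)
    (d τ M k : ℕ) : (stages ev cand d τ M k).length = k * (1 + 4 * q) := by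
  simp [stages, List.length_flatMap, length_stage]

open Finset in
theorem Good.stages {ev : X → Fin q → Fin q} {cand : ℕ → X → Finset C → Fin R → Finset C}
    {τ d M : ℕ} (hev1 : ∀ x y, x ≠ y → #{t | ev x t = ev y t} ≤ d)
    (hev2 : ∀ x c, #{t | ev x t = c} ≤ d) (hq : 0 < q)
    (hcand : ∀ m ≤ M, IsCandidates (cand m) (2 * d * m / q) τ (m / 2 + 1))
    {x₀ : V → X} (hx : ∀ v u, G.Adj v u → x₀ v ≠ x₀ u)
    {L₀ : V → Finset C} {f : V → NodeState X C q R} (hf : Good G x₀ L₀ f)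
    (hM : ∀ v, (f v).col = none → #(f v).L ≤ M) (k : ℕ) :
    Good G x₀ L₀ (runSteps G (stages ev cand d τ M k) f) ∧
      ∀ v, (runSteps G (stages ev cand d τ M k) f v).col = none →
        #(runSteps G (stages ev cand d τ M k) f v).L ≤ M / 2 ^ k := by
  induction k with
  | zero =>
    refine ⟨hf, fun v hv => ?_⟩
    rw [pow_zero, Nat.div_one]
    exact hM v hv
  | succ k ih =>
    have e : NodeState.stages ev cand d τ M (k + 1) = NodeState.stages ev cand d τ M k ++
        NodeState.stage ev (cand (M / 2 ^ k)) (2 * d * (M / 2 ^ k) / q) τ (M / 2 ^ k / 2 + 1) := by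
      simp [NodeState.stages, List.range_succ, List.flatMap_append]
    rw [e, runSteps_append]
    obtain ⟨hg, hs⟩ := ih.1.stage hev1 hev2 (Nat.lt_mul_div_succ _ hq)
      (hcand _ (Nat.div_le_self _ _)) hx ih.2 _ rfl
    refine ⟨hg, fun v hv => ?_⟩
    have := hs v hv
    rw [pow_succ, ← Nat.div_div_eq_div_mul]
    omega

/-- Once `M / 2 ^ k = 0`, an uncolored node would have an empty list, while `card_lt` makes its list
nonempty. -/
theorem runSteps_proper {ev : X → Fin q → Fin q} {cand : ℕ → X → Finset C → Fin R → Finset C}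
    {τ d M : ℕ} (hev1 : ∀ x y, x ≠ y → (Finset.univ.filter fun t => ev x t = ev y t).card ≤ d)
    (hev2 : ∀ x c, (Finset.univ.filter fun t => ev x t = c).card ≤ d) (hq : 0 < q)
    (hcand : ∀ m ≤ M, IsCandidates (cand m) (2 * d * m / q) τ (m / 2 + 1))
    {x₀ : V → X} (hx : ∀ v u, G.Adj v u → x₀ v ≠ x₀ u)
    {L₀ : V → Finset C} {f : V → NodeState X C q R} (hf : Good G x₀ L₀ f)
    (hM : ∀ v, (f v).col = none → (f v).L.card ≤ M) {k : ℕ} (hk : M < 2 ^ k) :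
    ∃ c : V → C, (∀ v, (runSteps G (stages ev cand d τ M k) f v).col = some (c v)) ∧
      (∀ v, c v ∈ L₀ v) ∧ ∀ v u, G.Adj v u → c v ≠ c u := by
  obtain ⟨hg, hs⟩ := hf.stages hev1 hev2 hq hcand hx hM k
  have hcol : ∀ v, ∃ c, (runSteps G (NodeState.stages ev cand d τ M k) f v).col = some c := by
    intro v
    by_contra hcon
    have hnone := Option.eq_none_iff_forall_ne_some.mpr fun c hc => hcon ⟨c, hc⟩
    have h1 := hs v hnone
    have h2 := hg.card_lt v hnone
    rw [Nat.div_eq_of_lt hk] at h1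
    omega
  choose c hc using hcol
  exact ⟨c, hc, fun v => hg.mem v _ (hc v), fun v u hvu he =>
    hg.proper v u _ hvu (hc v) (he ▸ hc u)⟩

/-- Lists never grow, so the same small set of states serves to encode the messages of all steps. -/
theorem card_L_le_of_mem_stages {ev : X → Fin q → Fin q}
    {cand : ℕ → X → Finset C → Fin R → Finset C} {τ d M k : ℕ} :
    ∀ g ∈ stages ev cand d τ M k, ∀ s m, (g s m).L.card ≤ s.L.card := by
  intro g hg s m
  simp only [stages, stage, List.mem_flatMap, List.cons_append, List.mem_cons, List.mem_append,
    List.mem_map, List.not_mem_nil, or_false] at hg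
  obtain ⟨i, -, h⟩ := hg
  rcases h with rfl | ⟨t, -, rfl⟩ | ⟨c, -, rfl | rfl | rfl⟩
  · exact le_rfl
  · rw [(joinClass_same ..).2.1]
  · unfold chooseSet; split_ifs <;> exact le_rfl
  · unfold chooseColor; split_ifs <;> exact le_rfl
  · unfold updateList
    split_ifs
    · classical exact Finset.card_le_card fun a ha => (Finset.mem_filter.mp ha).1
    · exact le_rfl

end NodeState

open NodeState in
theorem RoundComputable.runSteps {B : ℕ} {I S : Type} {Ω : Net I → Prop} {T r : ℕ}
    {f : ∀ N : Net I, N.V → S} (hf : RoundComputable B Ω T f) (Q : S → Prop)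
    (hQ : ∀ N, Ω N → ∀ v, Q (f N v)) (A : Finset S) (hQA : ∀ s, Q s → s ∈ A)
    (hA : A.card ≤ 2 ^ (r * B)) (steps : List (S → Multiset S → S))
    (hsteps : ∀ g ∈ steps, ∀ s m, Q s → Q (g s m)) :
    RoundComputable B Ω (T + steps.length * r) (fun N => runSteps N.G steps (f N)) := by
  induction steps generalizing T f with
  | nil => simpa [NodeState.runSteps] using hf
  | cons g steps ih =>
    have h1 := hf.bcast r id g A hA fun N hN v => hQA _ (hQ N hN v)
    have h2 := ih h1 (fun N hN v => hsteps g List.mem_cons_self _ _ (hQ N hN v))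
      (fun g' hg' => hsteps g' (List.mem_cons_of_mem _ hg'))
    rw [List.length_cons, Nat.succ_mul, add_comm _ r, ← add_assoc]
    exact h2

open Finset NodeState in
/-- List coloring from a given coloring with colors in `X`. -/
theorem RoundComputable.exists_listColoring {B Δ T r q d τ R k : ℕ} {X C : Type} [Fintype X]
    [Fintype C] [Nonempty C] [Nonempty (Fin R)] {Ω : Net (Finset C) → Prop}
    {x : ∀ N : Net (Finset C), N.V → X}
    (hx : RoundComputable B Ω T (fun N v => (N.input v, x N v)))
    (hxne : ∀ N, Ω N → ∀ v u, N.G.Adj v u → x N v ≠ x N u)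
    (hΩ : ∀ N, Ω N → ∀ v, N.G.degree v ≤ Δ ∧ N.G.degree v + 1 ≤ #(N.input v))
    (hq : q.Prime) (hd : 0 < d) (hX : Fintype.card X ≤ q ^ d)
    (hcand : ∀ m ≤ Δ + 1, ∃ cand : X → Finset C → Fin R → Finset C,
      IsCandidates cand (2 * d * m / q) τ (m / 2 + 1))
    (hk : Δ + 1 < 2 ^ k)
    (hr : Fintype.card X * (Fintype.card C + 1) ^ (Δ + 1) * (Fintype.card C + 1) * (q * q + 1) * R ≤
      2 ^ (r * B)) :
    ∃ c : ∀ N : Net (Finset C), N.V → C,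
      RoundComputable B Ω (T + k * (1 + 4 * q) * r) c ∧
      ∀ N, Ω N → (∀ v, c N v ∈ N.input v) ∧ ∀ v u, N.G.Adj v u → c N v ≠ c N u := by
  obtain ⟨ev, hev1, hev2⟩ := exists_polynomial_code hq hd hX
  choose! cand hcand using hcand
  obtain ⟨A, hA, hAc⟩ := exists_finset_states (X := X) (C := C) (q := q) (R := R) (Δ + 1)
  -- Lists are cut to exactly `deg + 1` colors: enough for the surplus `card_lt`, and at most `Δ +
  -- 1` colors to send.
  have htrim : ∀ (e : ℕ) (L : Finset C), ∃ L' : Finset C, e + 1 ≤ #L → L' ⊆ L ∧ #L' = e + 1 := by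
    intro e L
    by_cases h : e + 1 ≤ #L
    · obtain ⟨L', h'⟩ := exists_subset_card_eq h
      exact ⟨L', fun _ => h'⟩
    · exact ⟨∅, fun h' => (h h').elim⟩
  choose trim htrim using htrim
  let f : ∀ N : Net (Finset C), N.V → NodeState X C q R := fun N v =>
    ⟨x N v, trim (N.G.degree v) (N.input v), none, none, Classical.arbitrary _⟩
  have hf : RoundComputable B Ω T f := by
    have h1 := hx.exchange 0 (fun _ _ => ()) (fun e s _ =>
      (⟨s.2, trim e s.1, none, none, Classical.arbitrary _⟩ : NodeState X C q R)) univ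
      (by simp) (fun _ _ _ _ _ => mem_univ _)
    exact h1
  have hrun := hf.runSteps (fun s => #s.L ≤ Δ + 1)
    (fun N hN v => by
      have h1 := hΩ N hN v
      have h2 := (htrim (N.G.degree v) (N.input v) h1.2).2
      exact h2.trans_le (Nat.succ_le_succ h1.1))
    A hA (hAc.trans hr) (stages ev cand d τ (Δ + 1) k)
    (fun g hg s m hs => (card_L_le_of_mem_stages g hg s m).trans hs)
  rw [length_stages] at hrun
  refine ⟨fun N v => (NodeState.runSteps N.G (stages ev cand d τ (Δ + 1) k) (f N) v).col.getD
    (Classical.arbitrary C), hrun.map fun s => s.col.getD (Classical.arbitrary C), fun N hN => ?_⟩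
  have hgood : Good N.G (x N) N.input (f N) := by
    refine ⟨fun v => rfl, fun v => (htrim _ _ (hΩ N hN v).2).1, fun v a h => ?_, fun v u a _ h => ?_,
      fun v u a _ _ h => ?_, fun v _ => ?_⟩
    · exact (Option.some_ne_none a h.symm).elim
    · exact (Option.some_ne_none a h.symm).elim
    · exact (Option.some_ne_none a h.symm).elim
    · have h1 := (htrim _ _ (hΩ N hN v).2).2
      refine lt_of_le_of_lt (card_le_card (filter_subset _ _)) ?_
      rw [SimpleGraph.card_neighborFinset_eq_degree]
      exact (Nat.lt_succ_self _).trans_eq h1.symm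
  obtain ⟨c, hc, hmem, hne⟩ := runSteps_proper hev1 hev2 hq.pos hcand (hxne N hN) hgood
    (fun v _ => by
      have h1 := hΩ N hN v
      exact (htrim _ _ h1.2).2.trans_le (Nat.succ_le_succ h1.1)) hk
  simp only [hc, Option.getD_some]
  exact ⟨hmem, hne⟩

/-! ### Color lengths and `log*`. -/

theorem cvBits_add (l k j : ℕ) : cvBits l (k + j) = cvBits (cvBits l k) j := by
  induction j with
  | zero => rfl
  | succ j ih => rw [← add_assoc, cvBits, ih, cvBits]

theorem cvBits_le_max (l k : ℕ) : cvBits l k ≤ max l 3 := by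
  induction k with
  | zero => exact le_max_left _ _
  | succ k ih =>
    refine Nat.clog_le_of_le_pow ((Nat.mul_le_mul_left 2 ih).trans ?_)
    have : ∀ m, 3 ≤ m → 2 * m ≤ 2 ^ m := by
      intro m hm
      induction m, hm using Nat.le_induction with
      | base => norm_num
      | succ m hm ih => rw [pow_succ]; omega
    exact this _ (le_max_right _ _)

theorem clog_le_logb_add_one {m : ℕ} : (Nat.clog 2 m : ℝ) ≤ Real.logb 2 m + 1 := by
  rcases Nat.eq_zero_or_pos m with rfl | hm
  · simp
  · have h : 0 ≤ Real.logb 2 m := Real.logb_nonneg (by norm_num) (by exact_mod_cast hm)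
    have := (Nat.ceil_lt_add_one h).le
    rwa [← Nat.cast_ofNat, Real.natCeil_logb_natCast] at this

theorem logb_le_clog {m : ℕ} : Real.logb 2 m ≤ (Nat.clog 2 m : ℝ) := by
  have := Nat.le_ceil (Real.logb 2 m)
  rw [← Nat.cast_ofNat, Real.natCeil_logb_natCast] at this
  exact_mod_cast this

theorem exists_iterate_logb_le_one (x : ℝ) : ∃ k, (Real.logb 2)^[k] x ≤ 1 := by
  obtain ⟨m, hm⟩ := exists_nat_ge x
  induction m generalizing x with
  | zero => exact ⟨0, by simpa using hm.trans (by norm_num)⟩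
  | succ m ih =>
    by_cases h1 : x ≤ 1
    · exact ⟨0, h1⟩
    · push Not at h1
      have hlog : Real.logb 2 x ≤ m ∨ Real.logb 2 x ≤ 1 := by
        rcases le_total x 2 with h2 | h2
        · right
          rw [Real.logb_le_iff_le_rpow (by norm_num) (by linarith)]
          simpa using h2
        · left
          have h3 := Real.log_le_sub_one_of_pos (show 0 < x / 2 by linarith)
          rw [Real.log_div (by linarith) (by norm_num)] at h3
          have hlog2 := Real.log_two_gt_d9
          have h4 : Real.logb 2 x ≤ x - 1 := by
            rw [Real.logb, div_le_iff₀ (by linarith)]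
            nlinarith
          push_cast at hm
          linarith
      rcases hlog with h | h
      · obtain ⟨k, hk⟩ := ih _ h
        exact ⟨k + 1, hk⟩
      · exact ⟨1, h⟩

theorem iterate_logStar_le (x : ℝ) : (Real.logb 2)^[logStar x] x ≤ 1 :=
  Nat.sInf_mem (s := {k | (Real.logb 2)^[k] x ≤ 1}) (exists_iterate_logb_le_one x)

theorem one_lt_iterate_of_lt_logStar {x : ℝ} {k : ℕ} (h : k < logStar x) :
    1 < (Real.logb 2)^[k] x :=
  not_le.mp (Nat.notMem_of_lt_sInf h)

theorem logb_two_mul_le {x w : ℝ} (hw : 0 ≤ w) (hx : 1 < x) :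
    Real.logb 2 (x + w) ≤ Real.logb 2 x + Real.logb 2 (1 + w) := by
  rw [← Real.logb_mul (by linarith) (by linarith)]
  exact Real.logb_le_logb_of_le (by norm_num) (by linarith) (by nlinarith)

/-- Each step takes a logarithm up to a constant. The additive error `c + 5` reproduces itself,
since `log₂ (x + w) ≤ log₂ x + log₂ (1 + w)` for `x > 1` and `2 + log₂ (c + 6) ≤ c + 5`. -/
theorem cvBits_le_iterate {c n : ℕ} (hc : 1 ≤ c) (j : ℕ) (hj : j + 1 < logStar n) :
    (cvBits (c * Nat.clog 2 n) (j + 1) : ℝ) ≤ (Real.logb 2)^[j + 2] n + (c + 5 : ℕ) := by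
  have hn : 1 < n := by
    have := one_lt_iterate_of_lt_logStar (Nat.zero_lt_of_lt hj)
    rw [Function.iterate_zero, id_eq] at this
    exact_mod_cast this
  have hl : 0 < c * Nat.clog 2 n := Nat.mul_pos hc (Nat.clog_pos (by norm_num) hn)
  have hstep : ∀ m : ℕ, 0 < m → (Nat.clog 2 (2 * m) : ℝ) ≤ 2 + Real.logb 2 m := by
    intro m hm
    have h1 := clog_le_logb_add_one (m := 2 * m)
    have hm' : (0 : ℝ) < m := by exact_mod_cast hm
    push_cast at h1
    rw [Real.logb_mul (by norm_num) hm'.ne', Real.logb_self_eq_one (by norm_num)] at h1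
    linarith
  induction j with
  | zero =>
    have hx1 : 1 < Real.logb 2 (n : ℝ) := one_lt_iterate_of_lt_logStar (k := 1) hj
    have h1 := hstep _ hl
    have hc' : (1 : ℝ) ≤ c := by exact_mod_cast hc
    have h2 : ((c * Nat.clog 2 n : ℕ) : ℝ) ≤ (2 * c) * Real.logb 2 n := by
      push_cast
      have := clog_le_logb_add_one (m := n)
      nlinarith
    have h3 := Real.logb_le_logb_of_le (b := 2) (by norm_num) (by exact_mod_cast hl) h2
    rw [Real.logb_mul (by positivity) (by linarith), Real.logb_mul (by norm_num) (by linarith),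
      Real.logb_self_eq_one (by norm_num)] at h3
    have h4 : Real.logb 2 (c : ℝ) ≤ c := by
      rw [Real.logb_le_iff_le_rpow (by norm_num) (by linarith), Real.rpow_natCast]
      exact_mod_cast Nat.lt_two_pow_self.le
    show (Nat.clog 2 (2 * (c * Nat.clog 2 n)) : ℝ) ≤ Real.logb 2 (Real.logb 2 n) + (c + 5 : ℕ)
    push_cast at h1 h3 ⊢
    linarith
  | succ j ih =>
    have ih := ih (by omega)
    have hx : 1 < (Real.logb 2)^[j + 2] (n : ℝ) := one_lt_iterate_of_lt_logStar hj
    have hb := cvBits_pos hl (j + 1)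
    have h1 := hstep _ hb
    have h2 := Real.logb_le_logb_of_le (b := 2) (by norm_num) (by exact_mod_cast hb) ih
    have h3 := logb_two_mul_le (w := (c + 5 : ℕ)) (by positivity) hx
    have h4 : Real.logb 2 (1 + (c + 5 : ℕ) : ℝ) ≤ (c + 3 : ℕ) := by
      rw [Real.logb_le_iff_le_rpow (by norm_num) (by positivity), Real.rpow_natCast]
      have := Nat.lt_two_pow_self (n := c)
      have : 1 + (c + 5) ≤ 2 ^ (c + 3) := by rw [pow_add]; omega
      exact_mod_cast this
    rw [Function.iterate_succ_apply' (n := j + 2)]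
    show (Nat.clog 2 (2 * cvBits (c * Nat.clog 2 n) (j + 1)) : ℝ) ≤ _
    push_cast at h3 h4 ⊢
    push_cast at h2
    linarith

/-- For large `n`, already one reduction step makes two colors fit into `⌈log₂ n⌉` bits. -/
theorem two_mul_clog_le {c z : ℕ} (hz : 4 * c + 30 ≤ z) :
    2 * max (Nat.clog 2 (2 * (c * z))) 3 ≤ z := by
  have h : Nat.clog 2 (2 * (c * z)) ≤ z / 2 := by
    refine Nat.clog_le_of_le_pow ?_
    set w := z / 2 with hw
    have h1 : z ≤ 2 * w + 1 := by omega
    have h2 : 2 ^ w = 2 ^ (c + 6) * 2 ^ (w - c - 6) := by rw [← pow_add]; congr 1; omega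
    have h3 := Nat.lt_two_pow_self (n := c)
    have h4 := Nat.lt_two_pow_self (n := w - c - 6)
    have h5 : z ≤ 8 * 2 ^ (w - c - 6) := by omega
    rw [h2, pow_add]
    calc 2 * (c * z) ≤ 2 * (2 ^ c * (8 * 2 ^ (w - c - 6))) := by gcongr
      _ ≤ _ := by
        have : 0 ≤ 2 ^ c * 2 ^ (w - c - 6) := Nat.zero_le _
        nlinarith
  omega

/-- The number of rounds of the color reduction of Cole and Vishkin. -/
theorem exists_cvBits_le {c : ℕ} (hc : 1 ≤ c) : ∃ W, ∀ n : ℕ, 2 ≤ n → ∃ s : ℕ,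
    (s : ℝ) ≤ 1 / 2 * (logStar n : ℝ) ∧
    (∀ i, 0 < i → i ≤ s → 2 * cvBits (c * Nat.clog 2 n) (2 * i) ≤ Nat.clog 2 n) ∧
    cvBits (c * Nat.clog 2 n) (2 * (s + 1)) ≤ W := by
  refine ⟨c * (4 * c + 30) + c + 10, fun n hn => ?_⟩
  rcases lt_or_ge (Nat.clog 2 n) (4 * c + 30) with h | h
  -- For small `n` the identifiers have constant length from the beginning.
  · refine ⟨0, by rw [Nat.cast_zero]; positivity, fun i h1 h2 => by omega, (cvBits_le_max _ _).trans ?_⟩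
    have := Nat.mul_le_mul_left c h.le
    omega
  · have hmax : ∀ i, 0 < i → cvBits (c * Nat.clog 2 n) i ≤
        max (cvBits (c * Nat.clog 2 n) 1) 3 := by
      intro i hi
      obtain ⟨k, rfl⟩ : ∃ k, i = 1 + k := ⟨i - 1, by omega⟩
      rw [cvBits_add]
      exact cvBits_le_max _ _
    have hJ : 2 ≤ logStar n := by
      by_contra! hlt
      have hn2 : 2 < n := by
        by_contra! hle
        have := Nat.clog_mono_right 2 hle
        rw [show Nat.clog 2 2 = 1 by decide] at this
        omega
      have hle := iterate_logStar_le n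
      have hn2' : (2 : ℝ) < n := by exact_mod_cast hn2
      interval_cases hk : logStar n
      · simp only [Function.iterate_zero, id_eq] at hle
        linarith
      · simp only [Function.iterate_one] at hle
        rw [Real.logb_le_iff_le_rpow (by norm_num) (by linarith), Real.rpow_one] at hle
        linarith
    -- The last bound needs `logStar n - 1` steps; the `logStar n / 2 + 1` double steps provide at
    -- least as many.
    refine ⟨logStar n / 2, ?_, fun i hi _ => ?_, ?_⟩
    · have : ((logStar n / 2 : ℕ) : ℝ) ≤ (logStar n : ℝ) / 2 := Nat.cast_div_le
      linarith
    · have h1 := hmax (2 * i) (by omega)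
      have h2 := two_mul_clog_le h
      have h3 : cvBits (c * Nat.clog 2 n) 1 = Nat.clog 2 (2 * (c * Nat.clog 2 n)) := rfl
      omega
    · have h1 := cvBits_le_iterate hc (logStar n - 2) (n := n) (by omega)
      rw [show logStar n - 2 + 2 = logStar n by omega] at h1
      have h2 := iterate_logStar_le n
      have h3 : cvBits (c * Nat.clog 2 n) (logStar n - 2 + 1) ≤ c + 6 := by
        have : (cvBits (c * Nat.clog 2 n) (logStar n - 2 + 1) : ℝ) ≤ (c + 6 : ℕ) := by
          push_cast at h1 ⊢
          linarith
        exact_mod_cast this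
      obtain ⟨k, hk⟩ : ∃ k, 2 * (logStar n / 2 + 1) = (logStar n - 2 + 1) + k :=
        ⟨2 * (logStar n / 2 + 1) - (logStar n - 2 + 1), by omega⟩
      rw [hk, cvBits_add]
      refine (cvBits_le_max _ _).trans ?_
      have := Nat.zero_le (c * (4 * c + 30))
      omega

/-! ### Choice of the parameters. -/

/-- The base-two exponent of a quantity that is polynomial in `Δ`. -/
def ceilLog (Δ : ℕ) : ℕ := Nat.clog 2 (Δ + 2)

theorem add_two_le_two_pow_ceilLog (Δ : ℕ) : Δ + 2 ≤ 2 ^ ceilLog Δ := Nat.le_pow_clog (by norm_num) _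

theorem ceilLog_pos (Δ : ℕ) : 0 < ceilLog Δ := Nat.clog_pos (by norm_num) (by omega)

theorem card_states_le {Δ N P Q R Λ c₁ c₂ c₄ c₆ : ℕ} (hΔ : 0 < Δ) (hP : P ≤ 2 ^ (c₁ * Λ))
    (hN : N + 1 ≤ 2 ^ ((c₂ + 1) * Λ)) (hQ : Q ≤ 2 ^ (c₆ * Λ)) (hR : R ≤ 2 ^ (c₄ * Λ)) :
    P * (N + 1) ^ (Δ + 1) * (N + 1) * Q * R ≤
      2 ^ ((c₁ + 3 * (c₂ + 1) + c₆ + c₄) * Λ * Δ) := by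
  calc P * (N + 1) ^ (Δ + 1) * (N + 1) * Q * R
      ≤ 2 ^ (c₁ * Λ) * (2 ^ ((c₂ + 1) * Λ)) ^ (Δ + 1) * 2 ^ ((c₂ + 1) * Λ) *
        2 ^ (c₆ * Λ) * 2 ^ (c₄ * Λ) := by gcongr
    _ = 2 ^ ((c₁ + (c₂ + 1) * (Δ + 2) + c₆ + c₄) * Λ) := by
        rw [← pow_mul, ← pow_add, ← pow_add, ← pow_add, ← pow_add]; congr 1; ring
    _ ≤ 2 ^ ((c₁ + 3 * (c₂ + 1) + c₆ + c₄) * Δ * Λ) := by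
        refine Nat.pow_le_pow_right (by norm_num) (Nat.mul_le_mul_right _ ?_)
        nlinarith [Nat.mul_le_mul_left c₁ hΔ, Nat.mul_le_mul_left c₂ hΔ,
          Nat.mul_le_mul_left c₆ hΔ, Nat.mul_le_mul_left c₄ hΔ]
    _ = _ := by rw [mul_right_comm]

theorem card_tuples_le {Δ W Λ : ℕ} (h : Δ + 2 ≤ 2 ^ Λ) (hΛ : 0 < Λ) :
    (Δ * 2 ^ W + 1) ^ Δ ≤ 2 ^ ((1 + W) * Λ * Δ) := by
  rw [pow_mul 2 ((1 + W) * Λ)]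
  refine Nat.pow_le_pow_left ?_ Δ
  have hW : 1 ≤ 2 ^ W := Nat.one_le_two_pow
  calc Δ * 2 ^ W + 1 ≤ (Δ + 2) * 2 ^ W := by rw [add_mul]; omega
    _ ≤ 2 ^ Λ * 2 ^ W := Nat.mul_le_mul_right _ h
    _ = 2 ^ (Λ + W) := (pow_add ..).symm
    _ ≤ _ := by
      refine Nat.pow_le_pow_right (by norm_num) ?_
      have := Nat.le_mul_of_pos_right W hΛ
      rw [add_mul, one_mul]
      omega

set_option maxHeartbeats 400000 in
/-- The choice of the parameters of the algorithm. -/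
theorem exists_params (W c₂ : ℕ) : ∃ c : ℕ, ∀ Δ N : ℕ, 0 < Δ → N ≤ 2 ^ (c₂ * ceilLog Δ) →
    ∃ p d τ ρ R q : ℕ, p.Prime ∧ Δ * Δ < p ∧ Δ * 2 ^ W + 1 ≤ p ∧ q.Prime ∧ 0 < d ∧
      p * p ≤ q ^ d ∧ (p * p) ^ 2 * 2 ^ N < 2 ^ ρ ∧ (Δ + 1) * ρ < R ∧
      2 * R ^ 2 * ((Δ + 1) * τ + 1) ≤ 2 ^ τ ∧ 2 * d < q ∧
      64 * d ^ 2 * τ ^ 2 * (Δ + 1) ≤ q ^ 2 ∧ q ≤ c * ceilLog Δ ^ 2 * (Δ.sqrt + 1) ∧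
      p * p * (N + 1) ^ (Δ + 1) * (N + 1) * (q * q + 1) * R ≤ 2 ^ (c * ceilLog Δ * Δ) ∧
      (Δ * 2 ^ W + 1) ^ Δ ≤ 2 ^ (c * ceilLog Δ * Δ) := by
  -- In units of `Λ`, the constants `c₁`, `c₃`, `c₄`, `c₆` bound the base-two exponents of `p * p`,
  -- `ρ`, `R`, `q`. The parameters are `d = c₁ * Λ` and `τ = c₅ * Λ`.
  obtain ⟨c₁, hc₁⟩ : ∃ c, c = 2 * W + 6 := ⟨_, rfl⟩
  obtain ⟨c₃, hc₃⟩ : ∃ c, c = 2 * c₁ + c₂ + 1 := ⟨_, rfl⟩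
  obtain ⟨c₄, hc₄⟩ : ∃ c, c = c₃ + 1 := ⟨_, rfl⟩
  -- The requirement on `2 ^ τ` has `τ` on its other side too; half of the exponent absorbs this
  -- factor.
  obtain ⟨c₅, hc₅⟩ : ∃ c, c = 2 * (2 * c₄ + 4) := ⟨_, rfl⟩
  obtain ⟨c₆, hc₆⟩ : ∃ c, c = 16 * c₁ * c₅ + 3 := ⟨_, rfl⟩
  obtain ⟨c, hC, hC₇, hCW⟩ : ∃ c, 16 * c₁ * c₅ ≤ c ∧
      c₁ + 3 * (c₂ + 1) + (2 * c₆ + 1) + c₄ ≤ c ∧ 1 + W ≤ c :=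
    ⟨16 * c₁ * c₅ + (c₁ + 3 * (c₂ + 1) + (2 * c₆ + 1) + c₄) + (1 + W), by omega, by omega, by omega⟩
  refine ⟨c, fun Δ N hΔ hN => ?_⟩
  have hΛ := ceilLog_pos Δ
  have hΔΛ := add_two_le_two_pow_ceilLog Δ
  set Λ := ceilLog Δ with hΛdef
  have two_pow_mono : ∀ {i j : ℕ}, i ≤ j → 2 ^ i ≤ 2 ^ j :=
    fun h => Nat.pow_le_pow_right (by norm_num) h
  have le_mulΛ : ∀ i, i ≤ i * Λ := fun i => Nat.le_mul_of_pos_right i hΛ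
  have pow_add_pow : ∀ i j : ℕ, 2 ^ i + 2 ^ j ≤ 2 ^ (i + j + 1) := by
    intro i j
    have h1 := two_pow_mono (show i ≤ i + j by omega)
    have h2 := two_pow_mono (show j ≤ i + j by omega)
    rw [pow_succ]; omega
  obtain ⟨p, hp, hp1, hp2⟩ := Nat.exists_prime_lt_and_le_two_mul (Δ * Δ * 2 ^ W + 1) (by omega)
  have hW : 1 ≤ 2 ^ W := Nat.one_le_two_pow
  have hpΔ : Δ * Δ < p := by
    have := Nat.le_mul_of_pos_right (Δ * Δ) hW
    omega
  have hpW : Δ * 2 ^ W + 1 ≤ p := by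
    have := Nat.mul_le_mul_right (2 ^ W) (Nat.le_mul_of_pos_right Δ hΔ)
    omega
  have hΔW : Δ * Δ * 2 ^ W + 1 ≤ 2 ^ (2 * Λ + W) := by
    calc Δ * Δ * 2 ^ W + 1 ≤ (Δ * Δ + 1) * 2 ^ W := by rw [add_mul, one_mul]; omega
      _ ≤ (Δ + 2) * (Δ + 2) * 2 ^ W := by
        refine Nat.mul_le_mul_right _ ?_
        have : (Δ + 2) * (Δ + 2) = Δ * Δ + 4 * Δ + 4 := by ring
        omega
      _ ≤ 2 ^ Λ * 2 ^ Λ * 2 ^ W := by gcongr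
      _ = _ := by rw [← pow_add, ← pow_add]; congr 1; ring
  have hpp : p * p ≤ 2 ^ (c₁ * Λ) := by
    have h1 : p ≤ 2 ^ (2 * Λ + W + 1) := by rw [pow_succ]; omega
    refine (Nat.mul_le_mul h1 h1).trans ?_
    rw [← pow_add]
    refine two_pow_mono ?_
    have := le_mulΛ W
    have e : (2 * W + 6) * Λ = 2 * (W * Λ) + 6 * Λ := by ring
    rw [hc₁]; omega
  have hρ : (p * p) ^ 2 * 2 ^ N < 2 ^ (2 * c₁ * Λ + N + 1) := by
    calc (p * p) ^ 2 * 2 ^ N ≤ (2 ^ (c₁ * Λ)) ^ 2 * 2 ^ N := by gcongr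
      _ = 2 ^ (2 * c₁ * Λ + N) := by rw [← pow_mul, ← pow_add]; congr 1; ring
      _ < _ := Nat.pow_lt_pow_right (by norm_num) (Nat.lt_succ_self _)
  set ρ := 2 * c₁ * Λ + N + 1 with hρdef
  have hρle : ρ ≤ 2 ^ (c₃ * Λ) := by
    have h1 := Nat.lt_two_pow_self (n := 2 * c₁ * Λ)
    have h2 := pow_add_pow (2 * c₁ * Λ) (c₂ * Λ)
    have h3 : 2 ^ (2 * c₁ * Λ + c₂ * Λ + 1) ≤ 2 ^ (c₃ * Λ) :=
      two_pow_mono (by rw [hc₃, add_mul, add_mul, one_mul]; omega)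
    omega
  have hR : (Δ + 1) * ρ + 1 ≤ 2 ^ (c₄ * Λ) := by
    calc (Δ + 1) * ρ + 1 ≤ (Δ + 2) * ρ := by
          rw [show (Δ + 2) * ρ = (Δ + 1) * ρ + ρ by ring]; omega
      _ ≤ 2 ^ Λ * 2 ^ (c₃ * Λ) := Nat.mul_le_mul hΔΛ hρle
      _ = _ := by rw [← pow_add, hc₄]; congr 1; ring
  have hτ : 2 * ((Δ + 1) * ρ + 1) ^ 2 * ((Δ + 1) * (c₅ * Λ) + 1) ≤ 2 ^ (c₅ * Λ) := by
    have h1 : c₅ * Λ + 1 ≤ 2 ^ ((2 * c₄ + 4) * Λ + 1) := by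
      have := Nat.lt_two_pow_self (n := (2 * c₄ + 4) * Λ)
      have e : c₅ * Λ = 2 * ((2 * c₄ + 4) * Λ) := by rw [hc₅]; ring
      rw [pow_succ]; omega
    calc 2 * ((Δ + 1) * ρ + 1) ^ 2 * ((Δ + 1) * (c₅ * Λ) + 1)
        ≤ 2 * (2 ^ (c₄ * Λ)) ^ 2 * ((Δ + 2) * (c₅ * Λ + 1)) := by
          refine Nat.mul_le_mul (Nat.mul_le_mul_left 2 (Nat.pow_le_pow_left hR 2)) ?_
          calc (Δ + 1) * (c₅ * Λ) + 1 ≤ (Δ + 1) * (c₅ * Λ) + (Δ + 1) + (c₅ * Λ + 1) := by omega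
            _ = _ := by ring
      _ ≤ 2 * (2 ^ (c₄ * Λ)) ^ 2 * (2 ^ Λ * 2 ^ ((2 * c₄ + 4) * Λ + 1)) :=
          Nat.mul_le_mul_left _ (Nat.mul_le_mul hΔΛ h1)
      _ = 2 ^ ((4 * c₄ + 5) * Λ + 2) := by
          rw [← pow_mul, ← pow_add, ← pow_succ', ← pow_add]; congr 1; ring
      _ ≤ 2 ^ ((4 * c₄ + 5) * Λ + 2 * Λ) := two_pow_mono (by omega)
      _ ≤ _ := two_pow_mono (by
          rw [hc₅, ← add_mul]
          exact Nat.mul_le_mul_right _ (by omega))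
  have hd : 0 < c₁ * Λ := Nat.mul_pos (by omega) hΛ
  have hτpos : 0 < c₅ * Λ := Nat.mul_pos (by omega) hΛ
  -- The factor `√Δ` makes `q ^ 2` linear in `Δ`, as the comparison of `(β * τ) ^ 2` with `m`
  -- demands; `8 * d * τ` is the matching constant.
  obtain ⟨q, hq, hq1, hq2⟩ := Nat.exists_prime_lt_and_le_two_mul
    (8 * (c₁ * Λ) * (c₅ * Λ) * (Δ.sqrt + 1)) (by positivity)
  have hqd : p * p ≤ q ^ (c₁ * Λ) := hpp.trans (Nat.pow_le_pow_left hq.two_le _)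
  have h2d : 2 * (c₁ * Λ) < q := by
    refine lt_of_le_of_lt ?_ hq1
    have h1 : 1 ≤ (c₅ * Λ) * (Δ.sqrt + 1) := Nat.mul_pos hτpos (Nat.succ_pos _)
    calc 2 * (c₁ * Λ) ≤ 8 * (c₁ * Λ) * 1 := by omega
      _ ≤ 8 * (c₁ * Λ) * ((c₅ * Λ) * (Δ.sqrt + 1)) := Nat.mul_le_mul_left _ h1
      _ = _ := by ring
  have hqq : 64 * (c₁ * Λ) ^ 2 * (c₅ * Λ) ^ 2 * (Δ + 1) ≤ q ^ 2 := by
    have hs : Δ + 1 ≤ (Δ.sqrt + 1) * (Δ.sqrt + 1) := Nat.lt_succ_sqrt Δ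
    calc 64 * (c₁ * Λ) ^ 2 * (c₅ * Λ) ^ 2 * (Δ + 1)
        ≤ 64 * (c₁ * Λ) ^ 2 * (c₅ * Λ) ^ 2 * ((Δ.sqrt + 1) * (Δ.sqrt + 1)) := by gcongr
      _ = (8 * (c₁ * Λ) * (c₅ * Λ) * (Δ.sqrt + 1)) ^ 2 := by ring
      _ ≤ _ := Nat.pow_le_pow_left hq1.le 2
  have hqle : q ≤ 16 * c₁ * c₅ * Λ ^ 2 * (Δ.sqrt + 1) := by
    refine hq2.trans_eq ?_; ring
  have hq6 : q ≤ 2 ^ (c₆ * Λ) := by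
    have h1 : 16 * c₁ * c₅ ≤ 2 ^ (16 * c₁ * c₅ * Λ) :=
      Nat.lt_two_pow_self.le.trans (two_pow_mono (le_mulΛ _))
    have h2 : Λ ≤ 2 ^ Λ := Nat.lt_two_pow_self.le
    have h3 : Δ.sqrt + 1 ≤ 2 ^ Λ := by have := Nat.sqrt_le_self Δ; omega
    calc q ≤ 16 * c₁ * c₅ * Λ ^ 2 * (Δ.sqrt + 1) := hqle
      _ ≤ 2 ^ (16 * c₁ * c₅ * Λ) * (2 ^ Λ) ^ 2 * 2 ^ Λ := by gcongr
      _ = _ := by rw [← pow_mul, ← pow_add, ← pow_add, hc₆]; congr 1; ring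
  have hqq1 : q * q + 1 ≤ 2 ^ ((2 * c₆ + 1) * Λ) := by
    have h1 := Nat.mul_le_mul hq6 hq6
    have h2 : 2 ^ (c₆ * Λ) * 2 ^ (c₆ * Λ) + 1 ≤ 2 ^ (c₆ * Λ + c₆ * Λ + 1) := by
      rw [← pow_add, pow_succ]
      have := Nat.one_le_two_pow (n := c₆ * Λ + c₆ * Λ)
      omega
    have h3 : 2 ^ (c₆ * Λ + c₆ * Λ + 1) ≤ 2 ^ ((2 * c₆ + 1) * Λ) := two_pow_mono (by
      rw [add_mul, one_mul, mul_assoc]; omega)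
    omega
  have hN1 : N + 1 ≤ 2 ^ ((c₂ + 1) * Λ) := by
    have h1 := Nat.one_le_two_pow (n := c₂ * Λ)
    have h2 : 2 ^ (c₂ * Λ + 1) ≤ 2 ^ ((c₂ + 1) * Λ) := two_pow_mono (by rw [add_mul, one_mul]; omega)
    rw [pow_succ] at h2
    omega
  refine ⟨p, c₁ * Λ, c₅ * Λ, ρ, (Δ + 1) * ρ + 1, q, hp, hpΔ, hpW, hq, hd, hqd, hρ,
    Nat.lt_succ_self _, hτ, h2d, hqq, hqle.trans ?_, ?_, ?_⟩
  · exact Nat.mul_le_mul_right _ (Nat.mul_le_mul_right _ hC)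
  · exact (card_states_le hΔ hpp hN1 hqq1 hR).trans
      (two_pow_mono (Nat.mul_le_mul_right _ (Nat.mul_le_mul_right _ hC₇)))
  · exact (card_tuples_le hΔΛ hΛ).trans
      (two_pow_mono (Nat.mul_le_mul_right _ (Nat.mul_le_mul_right _ hCW)))

/-- As `β ≤ 2 * d * m / q`, the bound on `q ^ 2` gives `16 * (β * τ) ^ 2 ≤ m`. So lists of more than
half of `m` colors are large enough for candidate sets. -/
theorem outdegree_bounds {Δ d τ q m : ℕ} (h2d : 2 * d < q)
    (hqq : 64 * d ^ 2 * τ ^ 2 * (Δ + 1) ≤ q ^ 2) (hd : 0 < d) (hm : m ≤ Δ + 1) :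
    2 * d * m / q ≤ Δ + 1 ∧
      2 * (2 * d * m / q * τ + 1) * (2 * d * m / q * τ) < m / 2 + 1 := by
  set β := 2 * d * m / q with hβ
  have hq : 0 < q := by omega
  have hβq : β * q ≤ 2 * d * m := Nat.div_mul_le_self _ _
  constructor
  · refine le_trans ?_ hm
    refine Nat.le_of_mul_le_mul_right (hβq.trans ?_) hq
    rw [mul_comm m]
    exact Nat.mul_le_mul_right _ h2d.le
  · rcases Nat.eq_zero_or_pos (β * τ) with h0 | hpos
    · rw [h0]; simp
    · have hβpos : 0 < β := Nat.pos_of_mul_pos_right hpos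
      have hm0 : 0 < m := by
        rcases Nat.eq_zero_or_pos m with rfl | h
        · simp [hβ] at hβpos
        · exact h
      have h1 : 16 * (β * τ) ^ 2 ≤ m := by
        refine Nat.le_of_mul_le_mul_right ?_ (show 0 < 4 * d ^ 2 * m by positivity)
        calc 16 * (β * τ) ^ 2 * (4 * d ^ 2 * m) = β ^ 2 * (64 * d ^ 2 * τ ^ 2 * m) := by ring
          _ ≤ β ^ 2 * (64 * d ^ 2 * τ ^ 2 * (Δ + 1)) := by gcongr
          _ ≤ β ^ 2 * q ^ 2 := by gcongr
          _ = (β * q) ^ 2 := by ring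
          _ ≤ (2 * d * m) ^ 2 := by gcongr
          _ = _ := by ring
      have h2 : 2 * (β * τ + 1) * (β * τ) ≤ 4 * (β * τ) ^ 2 := by nlinarith
      omega

/-- The factor in `log log n` must become one in `log Δ`, because `Δ` may be far smaller than `log
n` and the final bound has only `log Δ` factors. If `log n ≤ Δ` then `log log n` is of order at most
`log Δ`; otherwise `Δ ≤ log n` needs no factor. -/
theorem exists_le_mul_clog (a : ℝ) (b : ℕ) : ∃ c : ℕ, ∀ n Δ : ℕ,
    (Δ : ℝ) ≤ softO a b (Real.logb 2 n) → 0 < Δ →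
    2 ≤ n ∧ Δ ≤ c * ceilLog Δ ^ b * Nat.clog 2 n := by
  refine ⟨⌈|a|⌉₊ + 1, fun n Δ h hΔ => ?_⟩
  have hn : 2 ≤ n := by
    by_contra! hlt
    have : Real.logb 2 n = 0 := by interval_cases n <;> simp
    rw [this, softO] at h
    simp only [mul_zero, zero_mul] at h
    have : Δ = 0 := by exact_mod_cast le_antisymm h (by positivity)
    omega
  refine ⟨hn, ?_⟩
  have hL := logb_le_clog (m := n)
  have hx0 : 0 ≤ Real.logb 2 (n : ℝ) := Real.logb_nonneg (by norm_num) (by exact_mod_cast (by omega : 1 ≤ n))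
  have hΛ : (1 : ℝ) ≤ (ceilLog Δ : ℝ) ^ b := one_le_pow₀ (by exact_mod_cast ceilLog_pos Δ)
  have hc : |a| ≤ (⌈|a|⌉₊ : ℝ) := Nat.le_ceil _
  have : (Δ : ℝ) ≤ (⌈|a|⌉₊ + 1) * (ceilLog Δ : ℝ) ^ b * (Nat.clog 2 n : ℝ) := by
    rcases le_total (Real.logb 2 (n : ℝ)) Δ with hle | hle
    · have h1 : Real.logb 2 (Real.logb 2 n + 2) ≤ ceilLog Δ := by
        refine le_trans ?_ (logb_le_clog (m := Δ + 2))
        refine Real.logb_le_logb_of_le (by norm_num) (by linarith) ?_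
        push_cast; linarith
      have h0 : 0 ≤ Real.logb 2 (Real.logb 2 n + 2) := Real.logb_nonneg (by norm_num) (by linarith)
      calc (Δ : ℝ) ≤ a * Real.logb 2 n * (Real.logb 2 (Real.logb 2 n + 2)) ^ b := h
        _ ≤ |a| * Real.logb 2 n * (Real.logb 2 (Real.logb 2 n + 2)) ^ b := by
            gcongr; exact le_abs_self a
        _ ≤ (⌈|a|⌉₊ + 1) * (Nat.clog 2 n : ℝ) * (ceilLog Δ : ℝ) ^ b := by gcongr; linarith
        _ = _ := by ring
    · calc (Δ : ℝ) ≤ 1 * 1 * (Nat.clog 2 n : ℝ) := by linarith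
        _ ≤ _ := by
          gcongr
          have : (0 : ℝ) ≤ ⌈|a|⌉₊ := by positivity
          linarith
  exact_mod_cast this

theorem sqrt_add_one_le {Δ : ℕ} (hΔ : 0 < Δ) : ((Δ.sqrt + 1 : ℕ) : ℝ) ≤ 2 * Real.sqrt Δ := by
  have h1 : ((Δ.sqrt : ℕ) : ℝ) ≤ Real.sqrt Δ := Real.nat_sqrt_le_real_sqrt
  have h2 : 1 ≤ Real.sqrt Δ := Real.one_le_sqrt.mpr (by exact_mod_cast hΔ)
  push_cast
  linarith

theorem ceilLog_le (Δ : ℕ) : (ceilLog Δ : ℝ) ≤ 3 * Real.logb 2 (Real.sqrt Δ + 2) := by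
  have hs : 0 ≤ Real.sqrt Δ := Real.sqrt_nonneg _
  have h1 := clog_le_logb_add_one (m := Δ + 2)
  have h2 : Real.logb 2 ((Δ + 2 : ℕ) : ℝ) ≤ Real.logb 2 ((Real.sqrt Δ + 2) ^ 2) := by
    refine Real.logb_le_logb_of_le (by norm_num) (by positivity) ?_
    have := Real.sq_sqrt (show (0 : ℝ) ≤ Δ by positivity)
    push_cast
    nlinarith
  have h3 : 1 ≤ Real.logb 2 (Real.sqrt Δ + 2) := by
    rw [Real.le_logb_iff_rpow_le (by norm_num) (by positivity), Real.rpow_one]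
    linarith
  rw [Real.logb_pow] at h2
  push_cast at h2
  simp only [ceilLog]
  push_cast at h1 ⊢
  linarith

theorem le_two_pow_of_le_mul_pow {K : ℝ} {k Δ N : ℕ} (h : (N : ℝ) ≤ K * ((Δ : ℝ) + 1) ^ k) :
    N ≤ 2 ^ ((⌈K⌉₊ + k) * ceilLog Δ) := by
  have h1 : N ≤ ⌈K⌉₊ * (Δ + 1) ^ k := by
    have : (N : ℝ) ≤ ⌈K⌉₊ * ((Δ : ℝ) + 1) ^ k :=
      h.trans (mul_le_mul_of_nonneg_right (Nat.le_ceil K) (by positivity))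
    exact_mod_cast this
  refine h1.trans ?_
  rw [add_mul, pow_add]
  refine Nat.mul_le_mul ?_ ?_
  · exact Nat.lt_two_pow_self.le.trans
      (Nat.pow_le_pow_right (by norm_num) (Nat.le_mul_of_pos_right _ (ceilLog_pos Δ)))
  · rw [mul_comm, pow_mul]
    exact Nat.pow_le_pow_left ((Nat.le_succ _).trans (add_two_le_two_pow_ceilLog Δ)) k

/-! ### Assembly and round count. -/

/-- The networks with `n` nodes, maximum degree at most `Δ`, identifiers of at most `l` bits and
lists that are larger than the degrees. -/
def ListColoringNet (C : Type) (n Δ l : ℕ) (N : Net (Finset C)) : Prop :=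
  Fintype.card N.V = n ∧ (∀ v, N.G.degree v ≤ Δ) ∧ ValidIds l N.ident ∧
    ∀ v, N.G.degree v + 1 ≤ (N.input v).card

/-- List coloring when `Δ = 0`. -/
theorem exists_solvesListColoring_zero (B n l : ℕ) (C : Type) [Nonempty C] :
    ∃ alg : CongestAlgorithm B (Finset C) C, SolvesListColoring alg n 0 l 0 := by
  classical
  refine ⟨{ State := C, init := fun _ _ L => Classical.epsilon fun c => c ∈ L,
            send := fun _ _ => BitMessage.empty B, recv := fun _ s _ => s, output := id },
    fun V _ G _ P ident L hn hΔ hid hL => ⟨fun v => ?_, fun u v h => ?_⟩⟩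
  · have : (L v).Nonempty := Finset.card_pos.mp (by have := hL v; omega)
    exact Classical.epsilon_spec (p := fun c => c ∈ L v) this
  · have h1 := hΔ u
    have h2 : 0 < G.degree u := (G.degree_pos_iff_exists_adj u).mpr ⟨v, h⟩
    omega

theorem exists_solvesListColoring (cId cMsg : ℕ) (hId : 1 ≤ cId) (hMsg : 1 ≤ cMsg) (a : ℝ) (b : ℕ)
    (K : ℝ) (k : ℕ) : ∃ (A : ℝ) (β : ℕ), ∀ (n Δ : ℕ),
      (Δ : ℝ) ≤ softO a b (Real.logb 2 n) →
      ∀ (C : Type) [Fintype C] [Nonempty C], (Fintype.card C : ℝ) ≤ K * ((Δ : ℝ) + 1) ^ k →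
      ∃ (T : ℕ) (alg : CongestAlgorithm (cMsg * Nat.clog 2 n) (Finset C) C),
        (T : ℝ) ≤ softO A β (Real.sqrt Δ) + 1 / 2 * (logStar n : ℝ) ∧
        SolvesListColoring alg n Δ (cId * Nat.clog 2 n) T := by
  obtain ⟨W, hW⟩ := exists_cvBits_le hId
  obtain ⟨c, hc⟩ := exists_params W (⌈K⌉₊ + k)
  obtain ⟨c', hc'⟩ := exists_le_mul_clog a b
  refine ⟨2 * (1 + 2 * cId + c * c' + c * c' * (1 + 4 * c) : ℕ) * 3 ^ (b + 4), b + 4,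
    fun n Δ h C _ _ hC => ?_⟩
  -- For `Δ = 0` the first term of the bound vanishes, so an algorithm without communication is
  -- used.
  rcases Nat.eq_zero_or_pos Δ with rfl | hΔ
  · obtain ⟨alg, halg⟩ := exists_solvesListColoring_zero (cMsg * Nat.clog 2 n) n
      (cId * Nat.clog 2 n) C
    refine ⟨0, alg, ?_, halg⟩
    simp [softO]
  obtain ⟨hn, hΔn⟩ := hc' n Δ h hΔ
  obtain ⟨s, hs, hbits, hfinal⟩ := hW n hn
  obtain ⟨p, d, τ, ρ, R, q, hp, hpΔ, hpW, hq, hd, hpq, hρ, hR, hτ, h2d, hqq, hqle, hstates, htuples⟩ :=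
    hc Δ (Fintype.card C) hΔ (le_two_pow_of_le_mul_pow hC)
  set z := Nat.clog 2 n with hz
  set Λ := ceilLog Δ with hΛdef
  have hzpos : 0 < z := Nat.clog_pos (by norm_num) hn
  have hΛpos : 0 < Λ := ceilLog_pos Δ
  have hzB : z ≤ cMsg * z := Nat.le_mul_of_pos_left _ hMsg
  have hl : 0 < cId * z := Nat.mul_pos hId hzpos
  let Ω := ListColoringNet C n Δ (cId * z)
  set r := c * c' * Λ ^ (b + 1) with hr
  have hrB : 2 ^ (c * Λ * Δ) ≤ 2 ^ (r * (cMsg * z)) := by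
    refine Nat.pow_le_pow_right (by norm_num) ?_
    calc c * Λ * Δ ≤ c * Λ * (c' * Λ ^ b * z) := Nat.mul_le_mul_left _ hΔn
      _ = r * z := by rw [hr]; ring
      _ ≤ _ := Nat.mul_le_mul_left _ hzB
  -- Exchange `0` sends two identifiers in `2 * cId` rounds, and the next `s` exchanges take one
  -- round each. Values beyond `s` only satisfy the bit bound and never enter the sum.
  obtain ⟨rs, hrs⟩ : ∃ rs : ℕ → ℕ, rs = fun i => if i = 0 then 2 * cId else
    if i ≤ s then 1 else 2 * cvBits (cId * z) (2 * i) := ⟨_, rfl⟩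
  have hrs_sum : ∑ i ∈ Finset.range (s + 1), rs i = s + 2 * cId := by
    rw [Finset.sum_range_succ']
    have : ∀ i ∈ Finset.range s, rs (i + 1) = 1 := by
      intro i hi
      rw [Finset.mem_range] at hi
      rw [hrs]
      simp only [Nat.succ_ne_zero, if_false]
      rw [if_pos (by omega)]
    rw [Finset.sum_congr rfl this, hrs]
    simp
  have hrs_bits : ∀ i, 2 * cvBits (cId * z) (2 * i) ≤ rs i * (cMsg * z) := by
    intro i
    rw [hrs]
    simp only
    split_ifs with h0 h1
    · subst h0
      show 2 * (cId * z) ≤ _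
      rw [← mul_assoc]
      exact Nat.mul_le_mul_left _ hzB
    · rw [one_mul]
      exact (hbits i (Nat.pos_of_ne_zero h0) h1).trans hzB
    · exact Nat.le_mul_of_pos_right _ (hzpos.trans_le hzB)
  obtain ⟨x, hx, hxne⟩ := exists_computable_coloring (Ω := Ω) (B := cMsg * z) (rp := Λ) (rq := r)
    (t := s + 1) hl (fun N hN => ⟨hN.2.1, hN.2.2.1⟩)
    (((Nat.le_add_right _ _).trans (add_two_le_two_pow_ceilLog Δ)).trans
      (Nat.pow_le_pow_right (by norm_num) (Nat.le_mul_of_pos_right _ (hzpos.trans_le hzB))))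
    hrs_bits hfinal (htuples.trans hrB) hΔ hp hpΔ hpW
  have : Nonempty (Fin R) := ⟨⟨0, by omega⟩⟩
  obtain ⟨col, hcol, hok⟩ := hx.exists_listColoring (Δ := Δ) (r := r) (q := q) (d := d) (τ := τ)
    (R := R) (k := Λ) hxne (fun N hN v => ⟨hN.2.1 v, hN.2.2.2 v⟩) hq hd (by simpa using hpq)
    (by
      intro m hm
      obtain ⟨hβ, hsz⟩ := outdegree_bounds h2d hqq hd hm
      obtain ⟨cand, h1, h2⟩ := exists_candidates (X := Fin p × Fin p) (C := C) (ρ := ρ) (R := R)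
        (β := 2 * d * m / q) (τ := τ) (s := m / 2 + 1) (by simpa using hρ)
        ((Nat.mul_le_mul_right ρ hβ).trans_lt hR)
        (le_trans (Nat.mul_le_mul_left _ (Nat.succ_le_succ (Nat.mul_le_mul_right τ hβ))) hτ) hsz
      exact ⟨cand, h1, h2⟩)
    ((Nat.lt_succ_self (Δ + 1)).trans_le (add_two_le_two_pow_ceilLog Δ))
    (by simpa using hstates.trans hrB)
  obtain ⟨alg, halg⟩ := hcol
  refine ⟨Λ + ∑ i ∈ Finset.range (s + 1), rs i + r + Λ * (1 + 4 * q) * r, alg, ?_, fun V _ G _ P ident L hVn hVΔ hVid hVL => ?_⟩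
  · rw [hrs_sum]
    have hnat : Λ + (s + 2 * cId) + r + Λ * (1 + 4 * q) * r ≤
        s + (1 + 2 * cId + c * c' + c * c' * (1 + 4 * c)) * Λ ^ (b + 4) * (Δ.sqrt + 1) := by
      have e1 : Λ ≤ Λ ^ (b + 4) * (Δ.sqrt + 1) := by
        calc Λ = Λ ^ 1 * 1 := by ring
          _ ≤ _ := Nat.mul_le_mul (Nat.pow_le_pow_right hΛpos (by omega)) (Nat.succ_pos _)
      have e2 : 1 ≤ Λ ^ (b + 4) * (Δ.sqrt + 1) := hΛpos.trans_le e1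
      have e3 : Λ ^ (b + 1) ≤ Λ ^ (b + 4) * (Δ.sqrt + 1) := by
        calc Λ ^ (b + 1) = Λ ^ (b + 1) * 1 := by ring
          _ ≤ _ := Nat.mul_le_mul (Nat.pow_le_pow_right hΛpos (by omega)) (Nat.succ_pos _)
      -- There are `Λ` stages of `1 + 4 * q` broadcasts of `r` rounds; `q` contributes `Λ ^ 2` and
      -- `r` contributes `Λ ^ (b + 1)`, hence the exponent `b + 4`.
      have e4 : Λ * (1 + 4 * q) * r ≤
          c * c' * (1 + 4 * c) * (Λ ^ (b + 4) * (Δ.sqrt + 1)) := by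
        have h1 : 1 + 4 * q ≤ (1 + 4 * c) * (Λ ^ 2 * (Δ.sqrt + 1)) := by
          have : 1 ≤ Λ ^ 2 * (Δ.sqrt + 1) := Nat.mul_pos (by positivity) (Nat.succ_pos _)
          calc 1 + 4 * q ≤ Λ ^ 2 * (Δ.sqrt + 1) + 4 * (c * Λ ^ 2 * (Δ.sqrt + 1)) := by omega
            _ = _ := by ring
        calc Λ * (1 + 4 * q) * r ≤ Λ * ((1 + 4 * c) * (Λ ^ 2 * (Δ.sqrt + 1))) * r := by gcongr
          _ = _ := by rw [hr]; ring
      have e5 : r ≤ c * c' * (Λ ^ (b + 4) * (Δ.sqrt + 1)) := Nat.mul_le_mul_left _ e3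
      have e6 : 2 * cId ≤ 2 * cId * (Λ ^ (b + 4) * (Δ.sqrt + 1)) := Nat.le_mul_of_pos_right _ e2
      calc _ = s + (Λ + 2 * cId + r + Λ * (1 + 4 * q) * r) := by ring
        _ ≤ s + (Λ ^ (b + 4) * (Δ.sqrt + 1) + 2 * cId * (Λ ^ (b + 4) * (Δ.sqrt + 1)) +
            c * c' * (Λ ^ (b + 4) * (Δ.sqrt + 1)) +
            c * c' * (1 + 4 * c) * (Λ ^ (b + 4) * (Δ.sqrt + 1))) := by
          gcongr
        _ = _ := by ring
    have hreal : ((Λ + (s + 2 * cId) + r + Λ * (1 + 4 * q) * r : ℕ) : ℝ) ≤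
        s + ((1 + 2 * cId + c * c' + c * c' * (1 + 4 * c) : ℕ) : ℝ) * (Λ : ℝ) ^ (b + 4) *
          ((Δ.sqrt + 1 : ℕ) : ℝ) := by exact_mod_cast hnat
    refine hreal.trans ?_
    rw [add_comm]
    refine add_le_add ?_ hs
    rw [softO]
    have hL0 : 0 ≤ Real.logb 2 (Real.sqrt Δ + 2) := Real.logb_nonneg (by norm_num) (by
      have := Real.sqrt_nonneg (Δ : ℝ); linarith)
    calc ((1 + 2 * cId + c * c' + c * c' * (1 + 4 * c) : ℕ) : ℝ) * (Λ : ℝ) ^ (b + 4) *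
          ((Δ.sqrt + 1 : ℕ) : ℝ)
        ≤ ((1 + 2 * cId + c * c' + c * c' * (1 + 4 * c) : ℕ) : ℝ) *
          (3 * Real.logb 2 (Real.sqrt Δ + 2)) ^ (b + 4) * (2 * Real.sqrt Δ) := by
          gcongr
          · exact ceilLog_le Δ
          · exact sqrt_add_one_le hΔ
      _ = _ := by rw [mul_pow]; ring
  · have hN : Ω ⟨V, G, P, ident, L⟩ := ⟨hVn, hVΔ, hVid, hVL⟩
    have hout := halg _ hN
    have := hok _ hN
    refine ⟨fun v => ?_, fun u v huv => ?_⟩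
    · exact (hout v).symm ▸ this.1 v
    · have h1 := this.2 u v huv
      rw [← hout u, ← hout v] at h1
      exact h1

/-- List coloring with the full lists is coloring. -/
theorem SolvesListColoring.exists_solvesColoring {B n Δ l T : ℕ}
    {alg : CongestAlgorithm B (Finset (Fin (Δ + 1))) (Fin (Δ + 1))}
    (h : SolvesListColoring alg n Δ l T) :
    ∃ alg' : CongestAlgorithm B Unit (Fin (Δ + 1)), SolvesColoring alg' n l T := by
  refine ⟨⟨alg.State, fun d i _ => alg.init d i Finset.univ, alg.send, alg.recv, alg.output⟩,
    fun V _ G _ P ident hn hΔ hid u v huv => ?_⟩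
  have key : ∀ t, CongestAlgorithm.stateAt
      (⟨alg.State, fun d i _ => alg.init d i Finset.univ, alg.send, alg.recv, alg.output⟩ :
        CongestAlgorithm B Unit (Fin (Δ + 1))) G P ident (fun _ => ()) t =
      alg.stateAt G P ident (fun _ => Finset.univ) t := by
    intro t
    induction t with
    | zero => rfl
    | succ t ih => funext v; simp only [CongestAlgorithm.stateAt, ih]
  have := (h V G P ident (fun _ => Finset.univ) hn hΔ hid
    (fun v => by simpa using hΔ v)).2 u v huv
  simp only [CongestAlgorithm.outputAt, key] at this ⊢
  exact this

theorem mainTheorem3 (cId cMsg : ℕ) (hId : 1 ≤ cId) (hMsg : 1 ≤ cMsg) (a : ℝ) (b : ℕ) :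
    (∀ (K : ℝ) (k : ℕ), ∃ (A : ℝ) (β : ℕ), ∀ (n Δ : ℕ),
      (Δ : ℝ) ≤ softO a b (Real.logb 2 n) →
      ∀ (C : Type) [Fintype C] [Nonempty C], (Fintype.card C : ℝ) ≤ K * ((Δ : ℝ) + 1) ^ k →
      ∃ (T : ℕ) (alg : CongestAlgorithm (cMsg * Nat.clog 2 n) (Finset C) C),
        (T : ℝ) ≤ softO A β (Real.sqrt Δ) + 1 / 2 * (logStar n : ℝ) ∧
        SolvesListColoring alg n Δ (cId * Nat.clog 2 n) T) ∧
    (∃ (A : ℝ) (β : ℕ), ∀ (n Δ : ℕ),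
      (Δ : ℝ) ≤ softO a b (Real.logb 2 n) →
      ∃ (T : ℕ) (alg : CongestAlgorithm (cMsg * Nat.clog 2 n) Unit (Fin (Δ + 1))),
        (T : ℝ) ≤ softO A β (Real.sqrt Δ) + 1 / 2 * (logStar n : ℝ) ∧
        SolvesColoring alg n (cId * Nat.clog 2 n) T) := by
  refine ⟨exists_solvesListColoring cId cMsg hId hMsg a b, ?_⟩
  -- With `K = k = 1` the color space `Fin (Δ + 1)` meets the size bound exactly.
  obtain ⟨A, β, h⟩ := exists_solvesListColoring cId cMsg hId hMsg a b 1 1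
  refine ⟨A, β, fun n Δ hΔ => ?_⟩
  obtain ⟨T, alg, hT, halg⟩ := h n Δ hΔ (Fin (Δ + 1)) (by simp)
  obtain ⟨alg', halg'⟩ := halg.exists_solvesColoring
  exact ⟨T, alg', hT, halg'⟩
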